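/- Let $d\ge 1$ and let $T$ be a linear operator on the Schwartz space of complex-valued functions on $\mathbb{R}^d$. Suppose that $T$ is a Calderón–Zygmund operator, that is: $T$ is bounded on $L^2(\mathbb{R}^d)$ (there is a constant $C$ with $\|Tf\|_{L^2}\le C\|f\|_{L^2}$ for all Schwartz functions $f$), and for every Schwartz function $f$ and almost every $x\in\mathbb{R}^d$ the following limit exists and satisfies $$(Tf)(x)=\mathrm{p.v.}\int_{\mathbb{R}^d}K(x,y)f(y)\,dy:=\lim_{\varepsilon\to0^+}\int_{|x-y|>\varepsilon}K(x,y)f(y)\,dy,$$ where the complex-valued kernel $K$ is of class $C^1$ on $\{(x,y)\in\mathbb{R}^d\times\mathbb{R}^d: x\ne y\}$ and there is a constant $C$ such that, for all $x\neq y$, $$|K(x,y)|\le C|x-y|^{-d},\qquad |\partial_xK(x,y)|+|\partial_yK(x,y)|\le C|x-y|^{-(d+1)}.$$ Then for every $1<p<\infty$ the discrete analogue $$(T_{\mathrm{dis}}f)(n)=\sum_{m\in\mathbb{Z}^d\setminus\{n\}}K(n,m)f(m),\qquad f\in\ell^p(\mathbb{Z}^d),\ n\in\mathbb{Z}^d,$$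 is given by absolutely convergent series and defines a bounded linear operator on $\ell^p(\mathbb{Z}^d)$. -/

import Mathlib

open MeasureTheory Filter Topology
open scoped SchwartzMap NNReal ENNReal

/-- `T`, a linear operator on the Schwartz space of `ℝ^d` with values in (measurable) functions,
is a Calderón–Zygmund operator with kernel `K`. The values of `K` on the diagonal are irrelevant. -/
structure IsCalderonZygmund {d : ℕ}
    (T : 𝓢(EuclideanSpace ℝ (Fin d), ℂ) →ₗ[ℂ] (EuclideanSpace ℝ (Fin d) → ℂ))
    (K : EuclideanSpace ℝ (Fin d) → EuclideanSpace ℝ (Fin d) → ℂ) : Prop where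
  /-- `T` is bounded on `L²(ℝ^d)`. -/
  bounded_L2 : ∃ C : ℝ≥0, ∀ f : 𝓢(EuclideanSpace ℝ (Fin d), ℂ),
    MemLp (T f) 2 volume ∧ eLpNorm (T f) 2 volume ≤ C * eLpNorm f 2 volume
  /-- The principal value integral exists at almost every point and represents `T f`. -/
  principal_value : ∀ f : 𝓢(EuclideanSpace ℝ (Fin d), ℂ),
    ∀ᵐ x : EuclideanSpace ℝ (Fin d),
      Tendsto (fun ε : ℝ => ∫ y in {y | ε < ‖x - y‖}, K x y * f y) (𝓝[>] 0) (𝓝 (T f x))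
  /-- The kernel is continuously differentiable off the diagonal. -/
  contDiffOn : ContDiffOn ℝ 1 (fun z : EuclideanSpace ℝ (Fin d) × EuclideanSpace ℝ (Fin d) =>
    K z.1 z.2) {z | z.1 ≠ z.2}
  /-- Size condition. -/
  size : ∃ C : ℝ, ∀ x y, x ≠ y → ‖K x y‖ ≤ C / ‖x - y‖ ^ d
  /-- Smoothness condition, on the gradients in each of the two variables. -/
  smoothness : ∃ C : ℝ, ∀ x y, x ≠ y →
    ‖fderiv ℝ (fun x' => K x' y) x‖ + ‖fderiv ℝ (fun y' => K x y') y‖ ≤ C / ‖x - y‖ ^ (d + 1)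

/-- A point of the lattice `ℤ^d`, as a point of Euclidean space. -/
noncomputable def latticePoint {d : ℕ} (n : Fin d → ℤ) : EuclideanSpace ℝ (Fin d) :=
  WithLp.toLp 2 fun i => (n i : ℝ)

/-- The terms, indexed by `m ≠ n`, of the series that defines `T_dis f (n)`. -/
noncomputable def discreteTerm {d : ℕ}
    (K : EuclideanSpace ℝ (Fin d) → EuclideanSpace ℝ (Fin d) → ℂ)
    (f : (Fin d → ℤ) → ℂ) (n : Fin d → ℤ) (m : {m : Fin d → ℤ // m ≠ n}) : ℂ :=
  K (latticePoint n) (latticePoint m.1) * f m.1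

/-- The discrete analogue `T_dis f (n) = ∑_{m ≠ n} K(n, m) f(m)`. -/
noncomputable def discreteAnalogue {d : ℕ}
    (K : EuclideanSpace ℝ (Fin d) → EuclideanSpace ℝ (Fin d) → ℂ)
    (f : (Fin d → ℤ) → ℂ) (n : Fin d → ℤ) : ℂ :=
  ∑' m : {m : Fin d → ℤ // m ≠ n}, discreteTerm K f n m

/-! The `ℓ²` bound is transferred from `ℝ^d` by sampling. Put a smooth bump `φ_n` of radius `1/4` at
each lattice point. The bumps have disjoint supports and equal `L²` norms, so after normalization
they are orthonormal, and the matrix `⟨T φ_m, φ_n⟩` is bounded on `ℓ²` because `T` is bounded on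
`L²` (`bumpMatrix_bound`). For `n ≠ m` the principal value is an ordinary integral, so the entry is
a double average of `K` near `(n, m)`. By the gradient bound it differs from `c² K(n, m)`, with `c =
∫ φ`, by `O(|n - m|^{-(d+1)})` (`IsSmoothKernel.norm_bumpMatrix_sub_le`). This error is summable
along rows and columns, so Schur's test absorbs it, together with the bounded diagonal
(`IsSmoothKernel.exists_matrixBound_two`).

From `ℓ²` to `ℓ^p` the argument is Calderón–Zygmund theory on the lattice itself. The gradient
bounds make the matrix regular in both indices. A dyadic stopping-time decomposition gives weak type
`(1, 1)` (`RegularMatrix.weakMatrixBound`), Marcinkiewicz interpolation gives `1 < p < 2`, and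
passing to the transpose gives `p > 2`.

All bounds are proved for finite sections, uniformly, so no convergence question arises before the
last step, where the finite sections yield absolute convergence and the operator on `ℓ^p`. -/

/-! ### Matrix inequalities: duality, Schur's test, Marcinkiewicz interpolation. -/

section MatrixBounds

variable {ι : Type*}

/-- The matrix `k` satisfies an `ℓ^p` bound with constant `C`, uniformly over finite sections. -/
def MatrixBound (k : ι → ι → ℂ) (p C : ℝ) : Prop :=
  ∀ (S N : Finset ι) (f : ι → ℂ),
    ∑ n ∈ N, ‖∑ m ∈ S, k n m * f m‖ ^ p ≤ C * ∑ m ∈ S, ‖f m‖ ^ p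

theorem norm_sum_mul_le_Lp_mul_Lq {p q : ℝ} (hpq : p.HolderConjugate q) (s : Finset ι)
    (f g : ι → ℂ) :
    ‖∑ i ∈ s, f i * g i‖ ≤ (∑ i ∈ s, ‖f i‖ ^ p) ^ (1 / p) * (∑ i ∈ s, ‖g i‖ ^ q) ^ (1 / q) := by
  refine (norm_sum_le _ _).trans ?_
  simp only [norm_mul]
  exact Real.inner_le_Lp_mul_Lq_of_nonneg s hpq (fun _ _ => norm_nonneg _) fun _ _ => norm_nonneg _

/-- A complex number of modulus `‖z‖ ^ (q - 1)` whose product with `z` is `‖z‖ ^ q`. -/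
theorem exists_mul_eq_norm_rpow {p q : ℝ} (hpq : p.HolderConjugate q) (z : ℂ) :
    ∃ w : ℂ, w * z = (‖z‖ ^ q : ℝ) ∧ ‖w‖ ^ p = ‖z‖ ^ q := by
  rcases eq_or_ne z 0 with rfl | hz
  · exact ⟨0, by simp [Real.zero_rpow hpq.symm.ne_zero],
      by simp [Real.zero_rpow hpq.symm.ne_zero, Real.zero_rpow hpq.ne_zero]⟩
  have hz' : 0 < ‖z‖ := norm_pos_iff.mpr hz
  refine ⟨(‖z‖ ^ q : ℝ) / z, div_mul_cancel₀ _ hz, ?_⟩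
  have h1 : ‖(((‖z‖ ^ q : ℝ) : ℂ)) / z‖ = ‖z‖ ^ (q - 1) := by
    rw [norm_div, Complex.norm_real, Real.norm_of_nonneg (by positivity), Real.rpow_sub_one hz'.ne']
  rw [h1, ← Real.rpow_mul hz'.le]
  congr 1
  have := hpq.symm.sub_one_mul_conj
  linarith

/-- Duality: the `q`-sum `X` of the output is paired with its dual sequence `w`, and the pairing
moves `k` onto `w`. The `p`-sum of `w` is again `X`, so Hölder leaves a power of `X` to cancel. -/
theorem MatrixBound.transpose {k : ι → ι → ℂ} {p q C : ℝ} (hpq : p.HolderConjugate q)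
    (hC : 0 ≤ C) (h : MatrixBound k p C) :
    MatrixBound (fun n m => k m n) q (C ^ (q / p)) := by
  intro S N f
  set x : ι → ℂ := fun n => ∑ m ∈ S, k m n * f m with hx
  choose w hw hw' using fun n => exists_mul_eq_norm_rpow hpq (x n)
  set X : ℝ := ∑ n ∈ N, ‖x n‖ ^ q with hX
  set F : ℝ := ∑ m ∈ S, ‖f m‖ ^ q with hF
  have hX0 : 0 ≤ X := Finset.sum_nonneg fun _ _ => by positivity
  have hF0 : 0 ≤ F := Finset.sum_nonneg fun _ _ => by positivity
  have hp0 := hpq.pos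
  have hq0 := hpq.symm.pos
  have e1 : ((X : ℝ) : ℂ) = ∑ m ∈ S, (∑ n ∈ N, k m n * w n) * f m := by
    rw [hX, Complex.ofReal_sum]
    simp_rw [← hw, hx, Finset.mul_sum, Finset.sum_mul]
    rw [Finset.sum_comm]
    refine Finset.sum_congr rfl fun _ _ => Finset.sum_congr rfl fun _ _ => by ring
  have e2 : X ≤ (C * X) ^ (1 / p) * F ^ (1 / q) := by
    calc X = ‖((X : ℝ) : ℂ)‖ := by rw [Complex.norm_real, Real.norm_of_nonneg hX0]
      _ ≤ (∑ m ∈ S, ‖∑ n ∈ N, k m n * w n‖ ^ p) ^ (1 / p) * F ^ (1 / q) := by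
          rw [e1]; exact norm_sum_mul_le_Lp_mul_Lq hpq _ _ _
      _ ≤ (C * X) ^ (1 / p) * F ^ (1 / q) := by
          gcongr
          refine (h N S w).trans_eq ?_
          simp_rw [hw', hX]
  change X ≤ C ^ (q / p) * F
  -- The cancellation of `X ^ (1 / p)` requires `X ≠ 0`.
  rcases hX0.eq_or_lt with hX0' | hXpos
  · rw [← hX0']; positivity
  have e3 : X ^ (1 / q) ≤ C ^ (1 / p) * F ^ (1 / q) := by
    have hsplit : X = X ^ (1 / q) * X ^ (1 / p) := by
      rw [← Real.rpow_add hXpos, one_div, one_div, add_comm, hpq.inv_add_inv_eq_one, Real.rpow_one]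
    have hpos : 0 < X ^ (1 / p) := by positivity
    refine le_of_mul_le_mul_right ?_ hpos
    rw [← hsplit]
    refine e2.trans_eq ?_
    rw [Real.mul_rpow hC hX0]; ring
  have e4 := Real.rpow_le_rpow (by positivity) e3 hq0.le
  rw [← Real.rpow_mul hX0, one_div_mul_cancel hq0.ne', Real.rpow_one,
    Real.mul_rpow (by positivity) (by positivity), ← Real.rpow_mul hC, ← Real.rpow_mul hF0,
    one_div_mul_cancel hq0.ne', Real.rpow_one] at e4
  rwa [one_div_mul_eq_div] at e4

/-- Schur's test. -/
theorem MatrixBound.of_sum_le {k : ι → ι → ℂ} {A : ℝ} (hA : 0 ≤ A)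
    (hrow : ∀ (S : Finset ι) n, ∑ m ∈ S, ‖k n m‖ ≤ A)
    (hcol : ∀ (N : Finset ι) m, ∑ n ∈ N, ‖k n m‖ ≤ A) : MatrixBound k 2 (A ^ 2) := by
  intro S N f
  simp only [Real.rpow_two]
  have h1 : ∀ n, ‖∑ m ∈ S, k n m * f m‖ ^ 2 ≤ A * ∑ m ∈ S, ‖k n m‖ * ‖f m‖ ^ 2 := by
    intro n
    -- Splitting `‖k‖ = √‖k‖ · √‖k‖` lets Cauchy–Schwarz spend one half on the row sum and keep the
    -- other for the column sum.
    have h2 : ‖∑ m ∈ S, k n m * f m‖ ≤ ∑ m ∈ S, √‖k n m‖ * (√‖k n m‖ * ‖f m‖) := by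
      refine (norm_sum_le _ _).trans_eq (Finset.sum_congr rfl fun m _ => ?_)
      rw [← mul_assoc, Real.mul_self_sqrt (norm_nonneg _), norm_mul]
    calc ‖∑ m ∈ S, k n m * f m‖ ^ 2 ≤ (∑ m ∈ S, √‖k n m‖ * (√‖k n m‖ * ‖f m‖)) ^ 2 := by gcongr
      _ ≤ (∑ m ∈ S, √‖k n m‖ ^ 2) * ∑ m ∈ S, (√‖k n m‖ * ‖f m‖) ^ 2 :=
          Finset.sum_mul_sq_le_sq_mul_sq _ _ _
      _ = (∑ m ∈ S, ‖k n m‖) * ∑ m ∈ S, ‖k n m‖ * ‖f m‖ ^ 2 := by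
          simp only [mul_pow, Real.sq_sqrt (norm_nonneg _)]
      _ ≤ _ := by gcongr; exact hrow S n
  calc ∑ n ∈ N, ‖∑ m ∈ S, k n m * f m‖ ^ 2
      ≤ ∑ n ∈ N, A * ∑ m ∈ S, ‖k n m‖ * ‖f m‖ ^ 2 := Finset.sum_le_sum fun n _ => h1 n
    _ = A * ∑ m ∈ S, (∑ n ∈ N, ‖k n m‖) * ‖f m‖ ^ 2 := by
        rw [← Finset.mul_sum, Finset.sum_comm]; simp only [Finset.sum_mul]
    _ ≤ A * ∑ m ∈ S, A * ‖f m‖ ^ 2 := by gcongr; exact hcol N _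
    _ = A ^ 2 * ∑ m ∈ S, ‖f m‖ ^ 2 := by rw [← Finset.mul_sum]; ring

theorem norm_add_sq_le_two_mul (z w : ℂ) : ‖z + w‖ ^ 2 ≤ 2 * (‖z‖ ^ 2 + ‖w‖ ^ 2) := by
  have := norm_add_le z w
  nlinarith [norm_nonneg (z + w), sq_nonneg (‖z‖ - ‖w‖), norm_nonneg z, norm_nonneg w]

theorem MatrixBound.add_two {k l : ι → ι → ℂ} {A B : ℝ} (hk : MatrixBound k 2 A)
    (hl : MatrixBound l 2 B) : MatrixBound (fun n m => k n m + l n m) 2 (2 * (A + B)) := by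
  intro S N f
  have h1 := hk S N f
  have h2 := hl S N f
  simp only [Real.rpow_two] at *
  calc ∑ n ∈ N, ‖∑ m ∈ S, (k n m + l n m) * f m‖ ^ 2
      ≤ ∑ n ∈ N, 2 * (‖∑ m ∈ S, k n m * f m‖ ^ 2 + ‖∑ m ∈ S, l n m * f m‖ ^ 2) := by
        refine Finset.sum_le_sum fun n _ => ?_
        simp only [add_mul, Finset.sum_add_distrib]
        exact norm_add_sq_le_two_mul _ _
    _ ≤ _ := by rw [← Finset.mul_sum, Finset.sum_add_distrib]; linarith

/-- The matrix `k` is of weak type `(1, 1)` with constant `A`, uniformly over finite sections. -/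
def WeakMatrixBound (k : ι → ι → ℂ) (A : ℝ) : Prop :=
  ∀ (S N : Finset ι) (f : ι → ℂ) (t : ℝ), 0 < t →
    t * (N.filter fun n => t < ‖∑ m ∈ S, k n m * f m‖).card ≤ A * ∑ m ∈ S, ‖f m‖

theorem mul_card_filter_le_sum (N : Finset ι) {x : ι → ℝ} (hx : ∀ n, 0 ≤ x n) (t : ℝ) :
    t * (N.filter fun n => t < x n).card ≤ ∑ n ∈ N, x n := by
  calc t * (N.filter fun n => t < x n).card = ∑ n ∈ N.filter fun n => t < x n, t := by
        rw [Finset.sum_const, nsmul_eq_mul, mul_comm]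
    _ ≤ ∑ n ∈ N.filter fun n => t < x n, x n :=
        Finset.sum_le_sum fun n hn => (Finset.mem_filter.mp hn).2.le
    _ ≤ ∑ n ∈ N, x n :=
        Finset.sum_le_sum_of_subset_of_nonneg (Finset.filter_subset _ _) fun n _ _ => hx n

theorem MatrixBound.sq_mul_card_le {k : ι → ι → ℂ} {B : ℝ} (h : MatrixBound k 2 B)
    (S N : Finset ι) (f : ι → ℂ) {t : ℝ} (ht : 0 < t) :
    t ^ 2 * (N.filter fun n => t < ‖∑ m ∈ S, k n m * f m‖).card ≤ B * ∑ m ∈ S, ‖f m‖ ^ 2 := by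
  have h1 := mul_card_filter_le_sum N (x := fun n => ‖∑ m ∈ S, k n m * f m‖ ^ 2)
    (fun n => by positivity) (t ^ 2)
  have h2 := h S N f
  simp only [Real.rpow_two] at h2
  refine le_trans (le_of_eq ?_) (h1.trans h2)
  congr 3
  refine Finset.filter_congr fun n _ => ?_
  rw [pow_lt_pow_iff_left₀ ht.le (norm_nonneg _) two_ne_zero]

theorem card_filter_lt_norm_add_le (N : Finset ι) (x y z : ι → ℂ) (hz : ∀ n ∈ N, z n = x n + y n)
    (t : ℝ) :
    ((N.filter fun n => t < ‖z n‖).card : ℝ) ≤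
      (N.filter fun n => t / 2 < ‖x n‖).card + (N.filter fun n => t / 2 < ‖y n‖).card := by
  classical
  norm_cast
  refine (Finset.card_le_card ?_).trans (Finset.card_union_le _ _)
  intro n hn
  simp only [Finset.mem_union, Finset.mem_filter] at hn ⊢
  by_contra! hcon
  have h1 := hcon.1 hn.1
  have h2 := hcon.2 hn.1
  have h3 := norm_add_le (x n) (y n)
  rw [← hz n hn.1] at h3
  linarith [hn.2]

/-- `f` is cut at height `t`: the weak bound serves the large values and the `ℓ²` bound the small
ones. Each is applied at level `t / 2`, whence the factors `2` and `4`. -/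
theorem card_filter_le_of_weak_of_two {k : ι → ι → ℂ} {A B : ℝ}
    (hw : WeakMatrixBound k A) (h2 : MatrixBound k 2 B) (S N : Finset ι) (f : ι → ℂ) {t : ℝ}
    (ht : 0 < t) :
    ((N.filter fun n => t < ‖∑ m ∈ S, k n m * f m‖).card : ℝ) ≤
      ∑ m ∈ S, if t < ‖f m‖ then 2 * A * ‖f m‖ / t else 4 * B * ‖f m‖ ^ 2 / t ^ 2 := by
  set f1 : ι → ℂ := fun m => if t < ‖f m‖ then f m else 0 with hf1
  set f2 : ι → ℂ := fun m => if t < ‖f m‖ then 0 else f m with hf2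
  have h := card_filter_lt_norm_add_le N (fun n => ∑ m ∈ S, k n m * f1 m)
    (fun n => ∑ m ∈ S, k n m * f2 m) (fun n => ∑ m ∈ S, k n m * f m) (fun n _ => by
      rw [← Finset.sum_add_distrib]
      refine Finset.sum_congr rfl fun m _ => ?_
      simp only [hf1, hf2]; split_ifs <;> simp) t
  have ha := hw S N f1 (t / 2) (by positivity)
  have hb := h2.sq_mul_card_le S N f2 (t := t / 2) (by positivity)
  have ha' : ((N.filter fun n => t / 2 < ‖∑ m ∈ S, k n m * f1 m‖).card : ℝ) ≤
      2 * A / t * ∑ m ∈ S, ‖f1 m‖ := by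
    rw [div_mul_eq_mul_div, le_div_iff₀ ht]; linarith
  have hb' : ((N.filter fun n => t / 2 < ‖∑ m ∈ S, k n m * f2 m‖).card : ℝ) ≤
      4 * B / t ^ 2 * ∑ m ∈ S, ‖f2 m‖ ^ 2 := by
    rw [div_mul_eq_mul_div, le_div_iff₀ (by positivity)]; linarith
  refine h.trans ((add_le_add ha' hb').trans_eq ?_)
  rw [Finset.mul_sum, Finset.mul_sum, ← Finset.sum_add_distrib]
  refine Finset.sum_congr rfl fun m _ => ?_
  simp only [hf1, hf2]
  split_ifs <;> simp <;> ring

theorem ofReal_rpow_eq_lintegral {p : ℝ} (hp : 0 < p) {a : ℝ} (ha : 0 ≤ a) :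
    ENNReal.ofReal (a ^ p) =
      ∫⁻ t in Set.Ioi (0 : ℝ), if t < a then ENNReal.ofReal (p * t ^ (p - 1)) else 0 := by
  have h1 : (fun t : ℝ => if t < a then ENNReal.ofReal (p * t ^ (p - 1)) else 0) =
      (Set.Iio a).indicator fun t => ENNReal.ofReal (p * t ^ (p - 1)) := by
    ext t; simp [Set.indicator_apply]
  have hint : IntervalIntegrable (fun t : ℝ => p * t ^ (p - 1)) volume 0 a :=
    (intervalIntegral.intervalIntegrable_rpow' (by linarith)).const_mul p
  rw [h1, lintegral_indicator measurableSet_Iio, Measure.restrict_restrict measurableSet_Iio,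
    Set.inter_comm, Set.Ioi_inter_Iio, ← restrict_Ioo_eq_restrict_Ioc.symm,
    ← ofReal_integral_eq_lintegral_ofReal, ← intervalIntegral.integral_of_le ha]
  · rw [intervalIntegral.integral_const_mul, integral_rpow (Or.inl (by linarith))]
    simp [Real.zero_rpow hp.ne', mul_div_cancel₀ _ hp.ne']
  · exact (intervalIntegrable_iff_integrableOn_Ioc_of_le ha).mp hint
  · filter_upwards [ae_restrict_mem measurableSet_Ioc] with t ht
    have := ht.1
    positivity

/-- Below `a` the integrand is a multiple of `t ^ (p - 2)`, integrable at `0` since `p > 1`; above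
`a` it is a multiple of `t ^ (p - 3)`, integrable at infinity since `p < 2`. -/
theorem lintegral_weak_strong_le {p : ℝ} (hp : 1 < p) (hp2 : p < 2) {A B : ℝ} (hA : 0 ≤ A)
    (hB : 0 ≤ B) {a : ℝ} (ha : 0 ≤ a) :
    ∫⁻ t in Set.Ioi (0 : ℝ), ENNReal.ofReal
      (p * t ^ (p - 1) * if t < a then A * a / t else B * a ^ 2 / t ^ 2) ≤
      ENNReal.ofReal ((p * A / (p - 1) + p * B / (2 - p)) * a ^ p) := by
  have hp1 : 0 < p - 1 := by linarith
  have hp2' : 0 < 2 - p := by linarith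
  rcases ha.eq_or_lt with rfl | ha
  · simp only [mul_zero, zero_div, ne_eq, OfNat.ofNat_ne_zero, not_false_eq_true, zero_pow,
      ite_self, ENNReal.ofReal_zero, lintegral_zero, zero_le]
  have hsplit : Set.Ioi (0 : ℝ) = Set.Ioc 0 a ∪ Set.Ioi a := (Set.Ioc_union_Ioi_eq_Ioi ha.le).symm
  rw [hsplit]
  refine (lintegral_union_le _ _ _).trans ?_
  rw [add_mul, ENNReal.ofReal_add (by positivity) (by positivity)]
  refine add_le_add ?_ ?_
  · have hint : IntervalIntegrable (fun t : ℝ => p * A * a * t ^ (p - 2)) volume 0 a :=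
      (intervalIntegral.intervalIntegrable_rpow' (by linarith)).const_mul _
    have e : ∫⁻ t in Set.Ioc 0 a, ENNReal.ofReal
        (p * t ^ (p - 1) * if t < a then A * a / t else B * a ^ 2 / t ^ 2) =
        ∫⁻ t in Set.Ioo 0 a, ENNReal.ofReal (p * A * a * t ^ (p - 2)) := by
      rw [← restrict_Ioo_eq_restrict_Ioc]
      refine setLIntegral_congr_fun measurableSet_Ioo fun t ht => ?_
      have h0 : 0 < t := ht.1
      simp only [if_pos ht.2]
      congr 1
      rw [show p - 1 = (p - 2) + 1 by ring, Real.rpow_add_one h0.ne']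
      field_simp
    rw [e, restrict_Ioo_eq_restrict_Ioc, ← ofReal_integral_eq_lintegral_ofReal,
      ← intervalIntegral.integral_of_le ha.le]
    · refine ENNReal.ofReal_le_ofReal (le_of_eq ?_)
      rw [intervalIntegral.integral_const_mul, integral_rpow (Or.inl (by linarith)),
        Real.zero_rpow (by linarith), show p - 2 + 1 = p - 1 by ring, Real.rpow_sub_one ha.ne']
      field_simp
      simp
    · exact (intervalIntegrable_iff_integrableOn_Ioc_of_le ha.le).mp hint
    · filter_upwards [ae_restrict_mem measurableSet_Ioc] with t ht
      have := ht.1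
      positivity
  · have e : ∫⁻ t in Set.Ioi a, ENNReal.ofReal
        (p * t ^ (p - 1) * if t < a then A * a / t else B * a ^ 2 / t ^ 2) =
        ∫⁻ t in Set.Ioi a, ENNReal.ofReal (p * B * a ^ 2 * t ^ (p - 3)) := by
      refine setLIntegral_congr_fun measurableSet_Ioi fun t ht => ?_
      have ht' : a < t := ht
      have h0 : 0 < t := ha.trans ht'
      simp only [if_neg ht'.not_gt]
      congr 1
      rw [show p - 1 = (p - 3) + 1 + 1 by ring, Real.rpow_add_one h0.ne',
        Real.rpow_add_one h0.ne']
      field_simp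
    rw [e, ← ofReal_integral_eq_lintegral_ofReal]
    · refine ENNReal.ofReal_le_ofReal (le_of_eq ?_)
      rw [integral_const_mul, integral_Ioi_rpow_of_lt (by linarith) ha,
        show p - 3 + 1 = p - 2 by ring, show p = (p - 2) + 1 + 1 by ring,
        Real.rpow_add_one ha.ne', Real.rpow_add_one ha.ne',
        show p - 2 + 1 + 1 - 2 = -(2 - p) by ring, show 2 - (p - 2 + 1 + 1) = 2 - p by ring]
      field_simp
      rw [neg_sub]
    · exact (integrableOn_Ioi_rpow_of_lt (by linarith) ha).const_mul _
    · filter_upwards [ae_restrict_mem measurableSet_Ioi] with t ht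
      have : 0 < t := ha.trans ht
      positivity

/-- Marcinkiewicz interpolation between weak type `(1, 1)` and strong type `(2, 2)`. -/
theorem MatrixBound.of_weak_of_two {k : ι → ι → ℂ} {A B p : ℝ} (hA : 0 ≤ A) (hB : 0 ≤ B)
    (hw : WeakMatrixBound k A) (h2 : MatrixBound k 2 B) (hp : 1 < p) (hp2 : p < 2) :
    MatrixBound k p (p * (2 * A) / (p - 1) + p * (4 * B) / (2 - p)) := by
  intro S N f
  have hp1 : 0 < p - 1 := by linarith
  have hp2' : 0 < 2 - p := by linarith
  set x : ι → ℂ := fun n => ∑ m ∈ S, k n m * f m with hx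
  rw [← ENNReal.ofReal_le_ofReal_iff (by positivity),
    ENNReal.ofReal_sum_of_nonneg fun _ _ => by positivity]
  have hmeas : ∀ n, Measurable fun t : ℝ =>
      if t < ‖x n‖ then ENNReal.ofReal (p * t ^ (p - 1)) else 0 := fun n =>
    Measurable.ite measurableSet_Iio (by fun_prop) measurable_const
  have hmeas' : ∀ m, Measurable fun t : ℝ => ENNReal.ofReal (p * t ^ (p - 1) *
      if t < ‖f m‖ then 2 * A * ‖f m‖ / t else 4 * B * ‖f m‖ ^ 2 / t ^ 2) := fun m =>
    (Measurable.mul (by fun_prop)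
      (Measurable.ite measurableSet_Iio (by fun_prop) (by fun_prop))).ennreal_ofReal
  calc ∑ n ∈ N, ENNReal.ofReal (‖x n‖ ^ p)
      = ∑ n ∈ N, ∫⁻ t in Set.Ioi (0 : ℝ),
          if t < ‖x n‖ then ENNReal.ofReal (p * t ^ (p - 1)) else 0 :=
        Finset.sum_congr rfl fun n _ => ofReal_rpow_eq_lintegral (by linarith) (norm_nonneg _)
    _ = ∫⁻ t in Set.Ioi (0 : ℝ), ∑ n ∈ N,
          if t < ‖x n‖ then ENNReal.ofReal (p * t ^ (p - 1)) else 0 :=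
        (lintegral_finsetSum _ fun n _ => hmeas n).symm
    _ ≤ ∫⁻ t in Set.Ioi (0 : ℝ), ∑ m ∈ S, ENNReal.ofReal (p * t ^ (p - 1) *
          if t < ‖f m‖ then 2 * A * ‖f m‖ / t else 4 * B * ‖f m‖ ^ 2 / t ^ 2) := by
        -- The layer-cake sum at height `t` is the density times the number of `n` with `t < ‖x n‖`.
        refine setLIntegral_mono' measurableSet_Ioi fun t ht => ?_
        have ht0 : 0 < t := ht
        rw [← Finset.sum_filter, Finset.sum_const, nsmul_eq_mul,
          ← ENNReal.ofReal_sum_of_nonneg, ← Finset.mul_sum, mul_comm,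
          ← ENNReal.ofReal_natCast, ← ENNReal.ofReal_mul (by positivity)]
        · refine ENNReal.ofReal_le_ofReal (mul_le_mul_of_nonneg_left ?_ (by positivity))
          exact card_filter_le_of_weak_of_two hw h2 S N f ht0
        · intro m _
          split_ifs <;> positivity
    _ = ∑ m ∈ S, ∫⁻ t in Set.Ioi (0 : ℝ), ENNReal.ofReal (p * t ^ (p - 1) *
          if t < ‖f m‖ then 2 * A * ‖f m‖ / t else 4 * B * ‖f m‖ ^ 2 / t ^ 2) :=
        lintegral_finsetSum _ fun m _ => hmeas' m
    _ ≤ ∑ m ∈ S, ENNReal.ofReal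
          ((p * (2 * A) / (p - 1) + p * (4 * B) / (2 - p)) * ‖f m‖ ^ p) :=
        Finset.sum_le_sum fun m _ =>
          lintegral_weak_strong_le hp hp2 (by positivity) (by positivity) (norm_nonneg _)
    _ = _ := by
        rw [← ENNReal.ofReal_sum_of_nonneg fun _ _ => by positivity, ← Finset.mul_sum]

end MatrixBounds

/-! ### Summability over `ℤ^d`. -/

section LatticeSums

variable {d : ℕ}

theorem summable_norm_rpow_lattice {r : ℝ} (hr : r < -d) :
    Summable fun q : Fin d → ℤ => ‖q‖ ^ r := by
  set b := (Pi.basisFun ℝ (Fin d)).restrictScalars ℤ with hb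
  have hrank : Module.finrank ℤ (Submodule.span ℤ (Set.range (Pi.basisFun ℝ (Fin d)))) = d := by
    rw [Module.finrank_eq_card_basis b, Fintype.card_fin]
  have h := ZLattice.summable_norm_rpow
    (Submodule.span ℤ (Set.range (Pi.basisFun ℝ (Fin d)))) r (by rwa [hrank])
  refine (b.equivFun.symm.toEquiv.summable_iff.mpr h).congr fun q => ?_
  have e : ((b.equivFun.symm q :
      Submodule.span ℤ (Set.range (Pi.basisFun ℝ (Fin d)))) : Fin d → ℝ) = fun i => (q i : ℝ) := by
    ext i
    rw [Module.Basis.equivFun_symm_apply]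
    simp [hb, Module.Basis.restrictScalars_apply, Finset.sum_apply, Pi.single_apply]
  have e2 : ‖(fun i => (q i : ℝ) : Fin d → ℝ)‖ = ‖q‖ := by
    simp [Pi.norm_def, nnnorm]
    rfl
  simp only [Function.comp_apply, LinearEquiv.coe_toEquiv]
  rw [Submodule.coe_norm, e, e2]

/-- The term at `q = 0` is `0` because `0⁻¹ = 0`, so the origin needs no exclusion. -/
theorem summable_inv_norm_pow_lattice :
    Summable fun q : Fin d → ℤ => (‖q‖⁻¹) ^ (d + 1) := by
  refine (summable_norm_rpow_lattice (d := d) (r := -((d + 1 : ℕ) : ℝ))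
    (by push_cast; linarith)).congr fun q => ?_
  rw [Real.rpow_neg (norm_nonneg _), Real.rpow_natCast, inv_pow]

/-- The sum of `‖q‖⁻¹ ^ (d + 1)` over the lattice. -/
noncomputable def latticeTailSum (d : ℕ) : ℝ := ∑' q : Fin d → ℤ, (‖q‖⁻¹) ^ (d + 1)

theorem latticeTailSum_nonneg : 0 ≤ latticeTailSum d := tsum_nonneg fun _ => by positivity

theorem sum_inv_norm_sub_pow_le (N : Finset (Fin d → ℤ)) (q : Fin d → ℤ) :
    ∑ n ∈ N, (‖n - q‖⁻¹) ^ (d + 1) ≤ latticeTailSum d := by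
  classical
  rw [← Finset.sum_image (s := N) (g := fun n => n - q) (f := fun x => (‖x‖⁻¹) ^ (d + 1))
    (fun a _ b _ h => sub_left_injective h)]
  exact summable_inv_norm_pow_lattice.sum_le_tsum _ fun _ _ => by positivity

theorem one_le_norm_lattice {q : Fin d → ℤ} (hq : q ≠ 0) : 1 ≤ ‖q‖ := by
  obtain ⟨i, hi⟩ := Function.ne_iff.mp hq
  refine le_trans ?_ (norm_le_pi_norm q i)
  rw [Int.norm_eq_abs]
  exact_mod_cast Int.one_le_abs hi

end LatticeSums

/-! ### Dyadic cubes of lattice points. -/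

section DyadicCubes

variable {d : ℕ}

/-- The index of the dyadic cube of side `2 ^ k` that contains `n`. -/
def dyadicCell (k : ℕ) (n : Fin d → ℤ) : Fin d → ℤ := fun i => n i / 2 ^ k

/-- The lattice points of the dyadic cube of side `2 ^ k` with index `q`. -/
noncomputable def dyadicCube (k : ℕ) (q : Fin d → ℤ) : Finset (Fin d → ℤ) :=
  Fintype.piFinset fun i => Finset.Ico (2 ^ k * q i) (2 ^ k * q i + 2 ^ k)

theorem mem_dyadicCube {k : ℕ} {q n : Fin d → ℤ} : n ∈ dyadicCube k q ↔ dyadicCell k n = q := by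
  simp only [dyadicCube, Fintype.mem_piFinset, Finset.mem_Ico, dyadicCell, funext_iff]
  refine forall_congr' fun i => ?_
  have h2 : (0 : ℤ) < 2 ^ k := by positivity
  -- Integer division by a positive number rounds down, so cells with negative coordinates are
  -- half-open cubes too.
  rw [Int.ediv_eq_iff_of_pos h2]
  constructor <;> rintro ⟨h, h'⟩ <;> constructor <;> linarith

theorem card_dyadicCube (k : ℕ) (q : Fin d → ℤ) : (dyadicCube k q).card = (2 ^ k) ^ d := by
  simp only [dyadicCube, Fintype.card_piFinset, Int.card_Ico, add_sub_cancel_left]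
  rw [Finset.prod_const, Finset.card_univ, Fintype.card_fin]
  congr 1

theorem dyadicCell_zero (n : Fin d → ℤ) : dyadicCell 0 n = n := by
  ext i; simp [dyadicCell]

theorem dyadicCell_eq_of_le {k l : ℕ} (hkl : k ≤ l) {n m : Fin d → ℤ}
    (h : dyadicCell k n = dyadicCell k m) : dyadicCell l n = dyadicCell l m := by
  obtain ⟨j, rfl⟩ := Nat.exists_eq_add_of_le hkl
  ext i
  have hi := congrFun h i
  simp only [dyadicCell] at hi ⊢
  rw [pow_add, ← Int.ediv_ediv_of_nonneg (by positivity), hi,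
    Int.ediv_ediv_of_nonneg (by positivity)]

theorem norm_sub_le_of_mem_dyadicCube {k : ℕ} {q m c : Fin d → ℤ} (hm : m ∈ dyadicCube k q)
    (hc : c ∈ dyadicCube k q) : ‖m - c‖ ≤ 2 ^ k := by
  rw [pi_norm_le_iff_of_nonneg (by positivity)]
  intro i
  simp only [dyadicCube, Fintype.mem_piFinset, Finset.mem_Ico] at hm hc
  obtain ⟨h1, h2⟩ := hm i
  obtain ⟨h3, h4⟩ := hc i
  rw [Int.norm_eq_abs]
  have : |m i - c i| ≤ 2 ^ k := by rw [abs_le]; constructor <;> linarith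
  exact_mod_cast this

/-- The positions of the two points inside their cells cost at most one side length, hence the `-
1`. -/
theorem two_pow_mul_norm_sub_le {k : ℕ} {q q' n c : Fin d → ℤ} (hn : n ∈ dyadicCube k q')
    (hc : c ∈ dyadicCube k q) : 2 ^ k * (‖q' - q‖ - 1) ≤ ‖n - c‖ := by
  suffices h : ‖q' - q‖ ≤ ‖n - c‖ / 2 ^ k + 1 by
    have h2 : (0 : ℝ) < 2 ^ k := by positivity
    have := (le_div_iff₀ h2).mp (sub_le_iff_le_add.mpr h)
    linarith
  rw [pi_norm_le_iff_of_nonneg (by positivity)]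
  intro i
  simp only [dyadicCube, Fintype.mem_piFinset, Finset.mem_Ico] at hn hc
  obtain ⟨h1, h2⟩ := hn i
  obtain ⟨h3, h4⟩ := hc i
  have h0 : (0 : ℤ) < 2 ^ k := by positivity
  have key : 2 ^ k * |q' i - q i| ≤ |n i - c i| + 2 ^ k := by
    rcases abs_cases (q' i - q i) with ⟨e, _⟩ | ⟨e, _⟩ <;> rw [e]
    · have := le_abs_self (n i - c i)
      nlinarith
    · have := neg_abs_le (n i - c i)
      nlinarith
  have key' : (2 : ℝ) ^ k * ‖(q' - q) i‖ ≤ ‖(n - c) i‖ + 2 ^ k := by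
    rw [Int.norm_eq_abs, Int.norm_eq_abs]
    exact_mod_cast key
  have := norm_le_pi_norm (n - c) i
  have h0' : (0 : ℝ) < 2 ^ k := by positivity
  rw [← sub_le_iff_le_add, le_div_iff₀ h0']
  linarith

/-- Summing a nonnegative function of the cell over lattice points. -/
theorem sum_comp_dyadicCell_le (k : ℕ) (N : Finset (Fin d → ℤ)) {g : (Fin d → ℤ) → ℝ}
    (hg : ∀ q, 0 ≤ g q) {W : ℝ} (hW : ∀ M : Finset (Fin d → ℤ), ∑ q ∈ M, g q ≤ W) :
    ∑ n ∈ N, g (dyadicCell k n) ≤ (2 ^ k) ^ d * W := by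
  classical
  rw [← Finset.sum_fiberwise_of_maps_to (t := N.image (dyadicCell k))
    (fun n hn => Finset.mem_image_of_mem _ hn)]
  calc ∑ q ∈ N.image (dyadicCell k), ∑ n ∈ N with dyadicCell k n = q, g (dyadicCell k n)
      ≤ ∑ q ∈ N.image (dyadicCell k), (2 ^ k) ^ d * g q := by
        refine Finset.sum_le_sum fun q _ => ?_
        rw [Finset.sum_congr rfl fun n hn => by rw [(Finset.mem_filter.mp hn).2],
          Finset.sum_const, nsmul_eq_mul]
        refine mul_le_mul_of_nonneg_right ?_ (hg q)
        have : (N.filter fun n => dyadicCell k n = q).card ≤ (2 ^ k) ^ d := by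
          rw [← card_dyadicCube k q]
          exact Finset.card_le_card fun n hn => mem_dyadicCube.mpr (Finset.mem_filter.mp hn).2
        exact_mod_cast this
    _ ≤ _ := by rw [← Finset.mul_sum]; gcongr; exact hW _

/-- The number of lattice points near a dyadic cube. -/
theorem card_filter_norm_dyadicCell_sub_le (k : ℕ) (N : Finset (Fin d → ℤ)) (q : Fin d → ℤ)
    (A : ℕ) :
    ((N.filter fun n => ‖dyadicCell k n - q‖ < A).card : ℝ) ≤ (2 ^ k) ^ d * (2 * A + 1) ^ d := by
  classical
  have h := sum_comp_dyadicCell_le k N (g := fun q' => if ‖q' - q‖ < A then 1 else 0)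
    (fun _ => by positivity) (W := (2 * A + 1) ^ d) fun M => by
      rw [Finset.sum_boole]
      have : (M.filter fun q' => ‖q' - q‖ < A) ⊆
          Fintype.piFinset fun i => Finset.Icc (q i - A) (q i + A) := by
        intro q' hq'
        simp only [Fintype.mem_piFinset, Finset.mem_Icc]
        intro i
        have h1 := (norm_le_pi_norm (q' - q) i).trans_lt (Finset.mem_filter.mp hq').2
        rw [Int.norm_eq_abs] at h1
        have h2 : |(q' - q) i| < A := by exact_mod_cast h1
        rw [abs_lt, Pi.sub_apply] at h2
        constructor <;> linarith
      have h3 := Finset.card_le_card this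
      rw [Fintype.card_piFinset] at h3
      have h4 : ∀ i, (Finset.Icc (q i - A) (q i + A)).card = 2 * A + 1 := by
        intro i
        rw [Int.card_Icc]
        omega
      simp only [h4, Finset.prod_const, Finset.card_univ, Fintype.card_fin] at h3
      exact_mod_cast h3
  rwa [Finset.sum_boole] at h

end DyadicCubes

/-! ### Cancellation away from a cube, and the stopping-time cubes. -/

section WeakType

variable {d : ℕ}

/-- A matrix on the lattice with the Lipschitz regularity of a Calderón–Zygmund kernel in its second
variable. -/
def RegularMatrix (k : (Fin d → ℤ) → (Fin d → ℤ) → ℂ) (C : ℝ) : Prop :=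
  ∀ n m c : Fin d → ℤ, n ≠ c → 2 * d * ‖m - c‖ ≤ ‖n - c‖ →
    ‖k n m - k n c‖ ≤ C * ‖m - c‖ / ‖n - c‖ ^ (d + 1)

/-- Mean zero allows `k n c` at the corner `c` to be subtracted from `k n m`. Regularity then gives
decay of order `d + 1` in the cell distance, which is summable. -/
theorem RegularMatrix.sum_norm_le {k : (Fin d → ℤ) → (Fin d → ℤ) → ℂ} {C : ℝ} (hC : 0 ≤ C)
    (hk : RegularMatrix k C) (j : ℕ) (q : Fin d → ℤ) (b : (Fin d → ℤ) → ℂ)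
    (hb : ∑ m ∈ dyadicCube j q, b m = 0) (N : Finset (Fin d → ℤ))
    (hN : ∀ n ∈ N, ((4 * d + 2 : ℕ) : ℝ) ≤ ‖dyadicCell j n - q‖) :
    ∑ n ∈ N, ‖∑ m ∈ dyadicCube j q, k n m * b m‖ ≤
      C * 2 ^ (d + 1) * latticeTailSum d * ∑ m ∈ dyadicCube j q, ‖b m‖ := by
  have h2 : (0 : ℝ) < 2 ^ j := by positivity
  set c : Fin d → ℤ := fun i => 2 ^ j * q i with hc
  have hcq : c ∈ dyadicCube j q := by
    simp only [dyadicCube, Fintype.mem_piFinset, Finset.mem_Ico, hc]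
    exact fun i => ⟨le_rfl, by have : (0 : ℤ) < 2 ^ j := by positivity
                               linarith⟩
  set β := ∑ m ∈ dyadicCube j q, ‖b m‖ with hβ
  have hβ0 : 0 ≤ β := Finset.sum_nonneg fun _ _ => norm_nonneg _
  have hpt : ∀ n ∈ N, ‖∑ m ∈ dyadicCube j q, k n m * b m‖ ≤
      C * 2 ^ (d + 1) * β / (2 ^ j) ^ d * (‖dyadicCell j n - q‖⁻¹) ^ (d + 1) := by
    intro n hn
    -- The threshold `4 d + 2` serves twice: `D ≥ 2` gives `D - 1 ≥ D / 2`, and `D ≥ 4 d` gives the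
    -- separation demanded by `RegularMatrix`.
    have hA := hN n hn
    push_cast at hA
    set D := ‖dyadicCell j n - q‖ with hD
    have hd0 : (0 : ℝ) ≤ d := Nat.cast_nonneg d
    have hD2 : 2 ≤ D := by linarith
    have hD4 : 4 * d ≤ D := by linarith
    have hdist := two_pow_mul_norm_sub_le (mem_dyadicCube.mpr rfl : n ∈ dyadicCube j _) hcq
    rw [← hD] at hdist
    have hlow : 2 ^ j * (D / 2) ≤ ‖n - c‖ := by
      refine le_trans ?_ hdist
      gcongr
      linarith
    have hpos : 0 < 2 ^ j * (D / 2) := by positivity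
    have hnc : n ≠ c := by
      rintro rfl
      rw [sub_self, norm_zero] at hlow
      linarith
    have e : ∑ m ∈ dyadicCube j q, k n m * b m =
        ∑ m ∈ dyadicCube j q, (k n m - k n c) * b m := by
      simp only [sub_mul, Finset.sum_sub_distrib]
      rw [← Finset.mul_sum, hb, mul_zero, sub_zero]
    rw [e]
    calc ‖∑ m ∈ dyadicCube j q, (k n m - k n c) * b m‖
        ≤ ∑ m ∈ dyadicCube j q, C * 2 ^ j / (2 ^ j * (D / 2)) ^ (d + 1) * ‖b m‖ := by
          refine (norm_sum_le _ _).trans (Finset.sum_le_sum fun m hm => ?_)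
          rw [norm_mul]
          refine mul_le_mul_of_nonneg_right ?_ (norm_nonneg _)
          have hmc := norm_sub_le_of_mem_dyadicCube hm hcq
          refine (hk n m c hnc ?_).trans ?_
          · refine le_trans ?_ hlow
            nlinarith [norm_nonneg (m - c)]
          · gcongr
      _ = _ := by
          rw [← Finset.mul_sum, ← hβ]
          have : (0 : ℝ) < D := by linarith
          rw [mul_pow, div_pow, pow_succ (2 ^ j : ℝ) d, inv_pow]
          field_simp
  calc ∑ n ∈ N, ‖∑ m ∈ dyadicCube j q, k n m * b m‖
      ≤ ∑ n ∈ N, C * 2 ^ (d + 1) * β / (2 ^ j) ^ d * (‖dyadicCell j n - q‖⁻¹) ^ (d + 1) :=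
        Finset.sum_le_sum hpt
    -- Each cell holds `(2 ^ j) ^ d` points, which cancels the denominator: the bound is independent
    -- of scale.
    _ ≤ C * 2 ^ (d + 1) * β / (2 ^ j) ^ d * ((2 ^ j) ^ d * latticeTailSum d) := by
        rw [← Finset.mul_sum]
        refine mul_le_mul_of_nonneg_left ?_ (by positivity)
        exact sum_comp_dyadicCell_le j N (g := fun q' => (‖q' - q‖⁻¹) ^ (d + 1))
          (fun _ => by positivity) fun M => sum_inv_norm_sub_pow_le M q
    _ = _ := by field_simp

/-- The stopping-time selection of the Calderón–Zygmund decomposition on the lattice. -/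
theorem exists_calderonZygmund_cubes (hd : d ≠ 0) (f : (Fin d → ℤ) → ℂ) (S : Finset (Fin d → ℤ))
    (hf : ∀ m ∉ S, f m = 0) {t : ℝ} (ht : 0 < t) :
    ∃ 𝒬 : Finset (ℕ × (Fin d → ℤ)),
      (∀ Q ∈ 𝒬, ∀ Q' ∈ 𝒬, Q ≠ Q' → Disjoint (dyadicCube Q.1 Q.2) (dyadicCube Q'.1 Q'.2)) ∧
      (∀ Q ∈ 𝒬, t * (2 ^ Q.1) ^ d < ∑ m ∈ dyadicCube Q.1 Q.2, ‖f m‖) ∧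
      (∀ Q ∈ 𝒬, ∑ m ∈ dyadicCube Q.1 Q.2, ‖f m‖ ≤ 2 ^ d * t * (2 ^ Q.1) ^ d) ∧
      ∀ n, (∀ Q ∈ 𝒬, n ∉ dyadicCube Q.1 Q.2) → ‖f n‖ ≤ t := by
  classical
  set F := ∑ m ∈ S, ‖f m‖ with hF
  set ν : ℕ → (Fin d → ℤ) → ℝ := fun k n => ∑ m ∈ dyadicCube k (dyadicCell k n), ‖f m‖ with hν
  set bad : ℕ → (Fin d → ℤ) → Prop := fun k n => t * (2 ^ k) ^ d < ν k n with hbad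
  have hνF : ∀ k n, ν k n ≤ F := by
    intro k n
    calc ν k n ≤ ∑ m ∈ dyadicCube k (dyadicCell k n) ∪ S, ‖f m‖ :=
          Finset.sum_le_sum_of_subset_of_nonneg Finset.subset_union_left fun _ _ _ => norm_nonneg _
      _ = F := (Finset.sum_subset Finset.subset_union_right fun m _ hm => by
          rw [hf m hm, norm_zero]).symm
  -- Bad scales are bounded: the total mass is `F`, while `t * (2 ^ k) ^ d ≥ t * k` since `d ≠ 0`.
  obtain ⟨K, hK⟩ := exists_nat_ge (F / t)
  have hbadK : ∀ k n, bad k n → k ≤ K := by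
    intro k n hkn
    have h1 : (k : ℝ) ≤ (2 ^ k) ^ d := by
      have h2 : k ≤ (2 ^ k) ^ d := (Nat.lt_two_pow_self).le.trans (Nat.le_self_pow hd _)
      exact_mod_cast h2
    have h3 : t * k < F := lt_of_le_of_lt (mul_le_mul_of_nonneg_left h1 ht.le)
      (lt_of_lt_of_le hkn (hνF k n))
    have h4 : (k : ℝ) < F / t := by rw [lt_div_iff₀ ht]; linarith
    exact_mod_cast (h4.trans_le hK).le
  -- The largest bad scale at `n`, that is, the maximal bad cube through `n`. The value is `0` if no
  -- scale is bad, so it is used only where one exists.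
  set κ : (Fin d → ℤ) → ℕ := fun n => Nat.findGreatest (fun k => bad k n) K with hκ
  have hκbad : ∀ n, (∃ k, bad k n) → bad (κ n) n := by
    rintro n ⟨k, hk⟩
    exact Nat.findGreatest_spec (P := fun k => bad k n) (hbadK k n hk) hk
  have hκmax : ∀ n k, bad k n → k ≤ κ n := fun n k hk =>
    Nat.le_findGreatest (hbadK k n hk) hk
  have hνcongr : ∀ k l n m, k ≤ l → dyadicCell k n = dyadicCell k m → ν l n = ν l m := by
    intro k l n m hkl h
    simp only [hν, dyadicCell_eq_of_le hkl h]
  -- All points of a selected cube share its stopping scale; disjointness of distinct selected cubes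
  -- follows.
  have hκcongr : ∀ n m, (∃ k, bad k n) → dyadicCell (κ n) m = dyadicCell (κ n) n → κ m = κ n := by
    intro n m hn h
    have h1 : bad (κ n) m := by
      have := hκbad n hn
      simp only [hbad] at this ⊢
      rwa [hνcongr _ _ _ _ le_rfl h]
    refine le_antisymm ?_ (hκmax m _ h1)
    have h2 := hκbad m ⟨_, h1⟩
    by_contra! hlt
    have h3 : bad (κ m) n := by
      simp only [hbad] at h2 ⊢
      rwa [hνcongr _ _ _ _ hlt.le h.symm]
    exact absurd (hκmax n _ h3) (not_le.mpr hlt)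
  refine ⟨(S.filter fun n => ∃ k, bad k n).image fun n => (κ n, dyadicCell (κ n) n), ?_, ?_, ?_, ?_⟩
  · intro Q hQ Q' hQ' hne
    obtain ⟨n, hn, rfl⟩ := Finset.mem_image.mp hQ
    obtain ⟨n', hn', rfl⟩ := Finset.mem_image.mp hQ'
    rw [Finset.disjoint_left]
    intro m hm hm'
    rw [mem_dyadicCube] at hm hm'
    simp only at hm hm'
    have e := hκcongr n m (Finset.mem_filter.mp hn).2 hm
    have e' := hκcongr n' m (Finset.mem_filter.mp hn').2 hm'
    exact hne (Prod.ext (e.symm.trans e') (by simp only; rw [← hm, ← hm', ← e, ← e']))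
  · intro Q hQ
    obtain ⟨n, hn, rfl⟩ := Finset.mem_image.mp hQ
    exact hκbad n (Finset.mem_filter.mp hn).2
  · intro Q hQ
    obtain ⟨n, hn, rfl⟩ := Finset.mem_image.mp hQ
    -- By maximality the parent cube is not bad; its volume is `2 ^ d` times larger.
    have h1 : ¬ bad (κ n + 1) n := fun h => by have := hκmax n _ h; omega
    simp only [hbad, not_lt] at h1
    have h2 : ν (κ n) n ≤ ν (κ n + 1) n := by
      refine Finset.sum_le_sum_of_subset_of_nonneg (fun m hm => ?_) fun _ _ _ => norm_nonneg _
      rw [mem_dyadicCube] at hm ⊢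
      exact dyadicCell_eq_of_le (Nat.le_succ _) hm
    refine (h2.trans h1).trans_eq ?_
    rw [pow_succ, mul_pow]
    ring
  · intro n hn
    by_contra! hlt
    have hnS : n ∈ S := by
      by_contra h
      rw [hf n h, norm_zero] at hlt
      linarith
    -- The cube of scale `0` is the single point `n`.
    have h0 : bad 0 n := by
      simp only [hbad, hν, dyadicCell_zero, pow_zero, one_pow, mul_one]
      refine hlt.trans_le ?_
      exact Finset.single_le_sum (f := fun m => ‖f m‖) (fun _ _ => norm_nonneg _)
        (mem_dyadicCube.mpr (dyadicCell_zero n))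
    exact hn _ (Finset.mem_image.mpr ⟨n, Finset.mem_filter.mpr ⟨hnS, 0, h0⟩, rfl⟩)
      (mem_dyadicCube.mpr rfl)

end WeakType

/-! ### Weak type `(1, 1)` and the `ℓ^p` bounds. -/

section WeakTypeBound

variable {d : ℕ}

/-- The Calderón–Zygmund decomposition on the lattice. -/
theorem exists_calderonZygmund_decomposition (hd : d ≠ 0) (f : (Fin d → ℤ) → ℂ)
    (S : Finset (Fin d → ℤ)) (hf : ∀ m ∉ S, f m = 0) {t : ℝ} (ht : 0 < t) :
    ∃ (𝒬 : Finset (ℕ × (Fin d → ℤ))) (g : (Fin d → ℤ) → ℂ)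
      (b : ℕ × (Fin d → ℤ) → (Fin d → ℤ) → ℂ),
      (∀ m, f m = g m + ∑ Q ∈ 𝒬, b Q m) ∧
      (∀ m, ‖g m‖ ≤ 2 ^ d * t) ∧
      (∀ Q, ∀ m ∉ dyadicCube Q.1 Q.2, b Q m = 0) ∧
      (∀ Q, ∑ m ∈ dyadicCube Q.1 Q.2, b Q m = 0) ∧
      (∑ Q ∈ 𝒬, ∑ m ∈ dyadicCube Q.1 Q.2, ‖b Q m‖ ≤ 2 * ∑ m ∈ S, ‖f m‖) ∧
      t * ∑ Q ∈ 𝒬, ((2 : ℝ) ^ Q.1) ^ d ≤ ∑ m ∈ S, ‖f m‖ := by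
  classical
  obtain ⟨𝒬, hdisj, hlow, hup, hout⟩ := exists_calderonZygmund_cubes hd f S hf ht
  set a : ℕ × (Fin d → ℤ) → ℂ := fun Q =>
    (∑ m ∈ dyadicCube Q.1 Q.2, f m) / ((2 : ℂ) ^ Q.1) ^ d with ha
  set b : ℕ × (Fin d → ℤ) → (Fin d → ℤ) → ℂ := fun Q m =>
    if m ∈ dyadicCube Q.1 Q.2 then f m - a Q else 0 with hb
  have hna : ∀ Q, ‖a Q‖ * ((2 : ℝ) ^ Q.1) ^ d ≤ ∑ m ∈ dyadicCube Q.1 Q.2, ‖f m‖ := by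
    intro Q
    have : ‖a Q‖ * ((2 : ℝ) ^ Q.1) ^ d = ‖∑ m ∈ dyadicCube Q.1 Q.2, f m‖ := by
      simp only [ha, norm_div, norm_pow, Complex.norm_ofNat]
      exact div_mul_cancel₀ _ (by positivity)
    rw [this]
    exact norm_sum_le _ _
  have hmass : ∑ Q ∈ 𝒬, ∑ m ∈ dyadicCube Q.1 Q.2, ‖f m‖ ≤ ∑ m ∈ S, ‖f m‖ := by
    rw [← Finset.sum_biUnion fun Q hQ Q' hQ' h => hdisj Q hQ Q' hQ' h]
    calc _ ≤ ∑ m ∈ (𝒬.biUnion fun Q => dyadicCube Q.1 Q.2) ∪ S, ‖f m‖ :=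
          Finset.sum_le_sum_of_subset_of_nonneg Finset.subset_union_left fun _ _ _ => norm_nonneg _
      _ = _ := (Finset.sum_subset Finset.subset_union_right fun m _ hm => by
          rw [hf m hm, norm_zero]).symm
  have hsumb : ∀ Q, ∑ m ∈ dyadicCube Q.1 Q.2, b Q m =
      ∑ m ∈ dyadicCube Q.1 Q.2, (f m - a Q) := fun Q =>
    Finset.sum_congr rfl fun m hm => if_pos hm
  have hcardC : ∀ Q : ℕ × (Fin d → ℤ),
      (((dyadicCube Q.1 Q.2).card : ℕ) : ℂ) = ((2 : ℂ) ^ Q.1) ^ d := by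
    intro Q; rw [card_dyadicCube]; push_cast; rfl
  have hcardR : ∀ Q : ℕ × (Fin d → ℤ),
      (((dyadicCube Q.1 Q.2).card : ℕ) : ℝ) = ((2 : ℝ) ^ Q.1) ^ d := by
    intro Q; rw [card_dyadicCube]; push_cast; rfl
  refine ⟨𝒬, fun m => f m - ∑ Q ∈ 𝒬, b Q m, b, fun m => by ring, fun m => ?_, fun Q m hm => ?_,
    fun Q => ?_, ?_, ?_⟩
  · by_cases hm : ∃ Q ∈ 𝒬, m ∈ dyadicCube Q.1 Q.2
    · obtain ⟨Q, hQ, hmQ⟩ := hm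
      have e : ∑ Q' ∈ 𝒬, b Q' m = f m - a Q := by
        rw [Finset.sum_eq_single Q]
        · exact if_pos hmQ
        · intro Q' hQ' hne
          exact if_neg fun h => Finset.disjoint_left.mp (hdisj Q' hQ' Q hQ hne) h hmQ
        · exact fun h => absurd hQ h
      simp only [e, sub_sub_cancel]
      -- On a selected cube `g` is the average `a Q`, controlled by the upper stopping bound.
      have h2 : (0 : ℝ) < ((2 : ℝ) ^ Q.1) ^ d := by positivity
      exact le_of_mul_le_mul_right ((hna Q).trans (hup Q hQ)) h2
    · push Not at hm
      have e : ∑ Q ∈ 𝒬, b Q m = 0 := Finset.sum_eq_zero fun Q hQ => if_neg (hm Q hQ)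
      simp only [e, sub_zero]
      refine (hout m hm).trans ?_
      exact le_mul_of_one_le_left ht.le (one_le_pow₀ one_le_two)
  · exact if_neg hm
  · rw [hsumb, Finset.sum_sub_distrib, Finset.sum_const, nsmul_eq_mul, hcardC]
    simp only [ha]
    rw [mul_div_cancel₀ _ (pow_ne_zero _ (pow_ne_zero _ two_ne_zero)), sub_self]
  · calc ∑ Q ∈ 𝒬, ∑ m ∈ dyadicCube Q.1 Q.2, ‖b Q m‖
        ≤ ∑ Q ∈ 𝒬, 2 * ∑ m ∈ dyadicCube Q.1 Q.2, ‖f m‖ := by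
          refine Finset.sum_le_sum fun Q _ => ?_
          calc ∑ m ∈ dyadicCube Q.1 Q.2, ‖b Q m‖
              ≤ ∑ m ∈ dyadicCube Q.1 Q.2, (‖f m‖ + ‖a Q‖) := by
                refine Finset.sum_le_sum fun m hm => ?_
                simp only [hb, if_pos hm]
                exact norm_sub_le _ _
            _ ≤ _ := by
                rw [Finset.sum_add_distrib, Finset.sum_const, nsmul_eq_mul, hcardR]
                linarith [hna Q]
      _ ≤ _ := by rw [← Finset.mul_sum]; gcongr
  · rw [Finset.mul_sum]
    exact (Finset.sum_le_sum fun Q hQ => (hlow Q hQ).le).trans hmass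

/-- A matrix that is bounded on `ℓ²` and regular in its second variable is of weak type `(1, 1)`. -/
theorem RegularMatrix.weakMatrixBound (hd : d ≠ 0) {k : (Fin d → ℤ) → (Fin d → ℤ) → ℂ} {B C : ℝ}
    (hB : 0 ≤ B) (hC : 0 ≤ C) (hk : RegularMatrix k C) (h2 : MatrixBound k 2 B) :
    WeakMatrixBound k (12 * 2 ^ d * B + (2 * ((4 * d + 2 : ℕ) : ℝ) + 1) ^ d +
      4 * (C * 2 ^ (d + 1) * latticeTailSum d)) := by
  classical
  intro S N f₀ t ht
  set f : (Fin d → ℤ) → ℂ := fun m => if m ∈ S then f₀ m else 0 with hf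
  have hfS : ∀ m ∉ S, f m = 0 := fun m hm => if_neg hm
  have hff₀ : ∀ m ∈ S, f m = f₀ m := fun m hm => if_pos hm
  have eF : ∑ m ∈ S, ‖f₀ m‖ = ∑ m ∈ S, ‖f m‖ :=
    Finset.sum_congr rfl fun m hm => by rw [hff₀ m hm]
  have eT : ∀ n, ∑ m ∈ S, k n m * f₀ m = ∑ m ∈ S, k n m * f m := fun n =>
    Finset.sum_congr rfl fun m hm => by rw [hff₀ m hm]
  simp only [eF, eT]
  set F := ∑ m ∈ S, ‖f m‖ with hF
  have hF0 : 0 ≤ F := Finset.sum_nonneg fun _ _ => norm_nonneg _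
  obtain ⟨𝒬, g, b, hfgb, hg, hbout, hbzero, hbsum, hQ⟩ :=
    exists_calderonZygmund_decomposition hd f S hfS ht
  -- The cubes may stick out of `S`; summing over `S'` changes nothing because `f` was extended by
  -- zero.
  set S' := S ∪ 𝒬.biUnion fun Q => dyadicCube Q.1 Q.2 with hS'
  have hcube : ∀ Q ∈ 𝒬, dyadicCube Q.1 Q.2 ⊆ S' := fun Q hQ =>
    (Finset.subset_biUnion_of_mem (fun Q : ℕ × (Fin d → ℤ) => dyadicCube Q.1 Q.2) hQ).trans
      Finset.subset_union_right
  have eT' : ∀ n, ∑ m ∈ S, k n m * f m = ∑ m ∈ S', k n m * f m := fun n =>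
    Finset.sum_subset Finset.subset_union_left fun m _ hm => by rw [hfS m hm, mul_zero]
  have eF' : F = ∑ m ∈ S', ‖f m‖ :=
    Finset.sum_subset Finset.subset_union_left fun m _ hm => by rw [hfS m hm, norm_zero]
  have eb : ∀ Q ∈ 𝒬, ∀ n, ∑ m ∈ S', k n m * b Q m = ∑ m ∈ dyadicCube Q.1 Q.2, k n m * b Q m :=
    fun Q hQ n => (Finset.sum_subset (hcube Q hQ) fun m _ hm => by
      rw [hbout Q m hm, mul_zero]).symm
  have enb : ∀ Q ∈ 𝒬, ∑ m ∈ S', ‖b Q m‖ = ∑ m ∈ dyadicCube Q.1 Q.2, ‖b Q m‖ :=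
    fun Q hQ => (Finset.sum_subset (hcube Q hQ) fun m _ hm => by
      rw [hbout Q m hm, norm_zero]).symm
  have hg1 : ∑ m ∈ S', ‖g m‖ ≤ 3 * F := by
    calc ∑ m ∈ S', ‖g m‖ ≤ ∑ m ∈ S', (‖f m‖ + ∑ Q ∈ 𝒬, ‖b Q m‖) := by
          refine Finset.sum_le_sum fun m _ => ?_
          have : g m = f m - ∑ Q ∈ 𝒬, b Q m := by rw [hfgb m]; ring
          rw [this]
          exact (norm_sub_le _ _).trans (by gcongr; exact norm_sum_le _ _)
      _ = F + ∑ Q ∈ 𝒬, ∑ m ∈ dyadicCube Q.1 Q.2, ‖b Q m‖ := by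
          rw [Finset.sum_add_distrib, ← eF', Finset.sum_comm]
          congr 1
          exact Finset.sum_congr rfl enb
      _ ≤ _ := by linarith
  have hg2 : ∑ m ∈ S', ‖g m‖ ^ 2 ≤ 2 ^ d * t * (3 * F) := by
    calc ∑ m ∈ S', ‖g m‖ ^ 2 ≤ ∑ m ∈ S', 2 ^ d * t * ‖g m‖ := by
          refine Finset.sum_le_sum fun m _ => ?_
          rw [pow_two]
          exact mul_le_mul_of_nonneg_right (hg m) (norm_nonneg _)
      _ ≤ _ := by rw [← Finset.mul_sum]; gcongr
  set A := 4 * d + 2 with hA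
  -- The exceptional set of dilated cubes is estimated only by its cardinality, at most a constant
  -- times `F / t`. Off it `RegularMatrix.sum_norm_le` applies to each `b Q`.
  set near : (Fin d → ℤ) → Prop := fun n => ∃ Q ∈ 𝒬, ‖dyadicCell Q.1 n - Q.2‖ < (A : ℝ)
    with hnear
  set N₁ := N.filter near with hN₁
  set N₂ := N.filter fun n => ¬ near n with hN₂
  have hcard₁ : t * (N₁.card : ℝ) ≤ (2 * (A : ℝ) + 1) ^ d * F := by
    have h3 : (N₁.card : ℝ) ≤ ∑ Q ∈ 𝒬, ((2 : ℝ) ^ Q.1) ^ d * (2 * (A : ℝ) + 1) ^ d := by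
      have hsub : N₁ ⊆ 𝒬.biUnion fun Q => N.filter fun n => ‖dyadicCell Q.1 n - Q.2‖ < (A : ℝ) := by
        intro n hn
        obtain ⟨hnN, Q, hQ, hQn⟩ := Finset.mem_filter.mp hn
        exact Finset.mem_biUnion.mpr ⟨Q, hQ, Finset.mem_filter.mpr ⟨hnN, hQn⟩⟩
      have h4 := (Finset.card_le_card hsub).trans Finset.card_biUnion_le
      have h5 : (N₁.card : ℝ) ≤
          ∑ Q ∈ 𝒬, ((N.filter fun n => ‖dyadicCell Q.1 n - Q.2‖ < (A : ℝ)).card : ℝ) := by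
        exact_mod_cast h4
      exact h5.trans (Finset.sum_le_sum fun Q _ => card_filter_norm_dyadicCell_sub_le _ _ _ _)
    rw [← Finset.sum_mul] at h3
    calc t * (N₁.card : ℝ) ≤ t * ((∑ Q ∈ 𝒬, ((2 : ℝ) ^ Q.1) ^ d) * (2 * (A : ℝ) + 1) ^ d) := by
          gcongr
      _ = (2 * (A : ℝ) + 1) ^ d * (t * ∑ Q ∈ 𝒬, ((2 : ℝ) ^ Q.1) ^ d) := by ring
      _ ≤ _ := by gcongr
  -- The constant is `4 · 3 · 2 ^ d`: `4` from the level `t / 2` squared, `3 * F` from the `ℓ¹` norm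
  -- of `g`, and `2 ^ d * t` from its supremum.
  have hgood : t * ((N₂.filter fun n => t / 2 < ‖∑ m ∈ S', k n m * g m‖).card : ℝ) ≤
      12 * 2 ^ d * B * F := by
    have h3 := h2.sq_mul_card_le S' N₂ g (t := t / 2) (by positivity)
    have h4 := h3.trans (mul_le_mul_of_nonneg_left hg2 hB)
    refine le_of_mul_le_mul_left ?_ (show 0 < t / 4 by positivity)
    calc t / 4 * (t * ((N₂.filter fun n => t / 2 < ‖∑ m ∈ S', k n m * g m‖).card : ℝ))
        = (t / 2) ^ 2 * ((N₂.filter fun n => t / 2 < ‖∑ m ∈ S', k n m * g m‖).card : ℝ) := by ring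
      _ ≤ _ := h4
      _ = _ := by ring
  set D := C * 2 ^ (d + 1) * latticeTailSum d with hD
  have hD0 : 0 ≤ D := by have := latticeTailSum_nonneg (d := d); positivity
  have hbad : t * ((N₂.filter fun n => t / 2 < ‖∑ m ∈ S', k n m * ∑ Q ∈ 𝒬, b Q m‖).card : ℝ) ≤
      4 * D * F := by
    have h3 := mul_card_filter_le_sum N₂
      (x := fun n => ‖∑ m ∈ S', k n m * ∑ Q ∈ 𝒬, b Q m‖) (fun _ => norm_nonneg _) (t / 2)
    have h4 : ∑ n ∈ N₂, ‖∑ m ∈ S', k n m * ∑ Q ∈ 𝒬, b Q m‖ ≤ D * (2 * F) := by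
      calc ∑ n ∈ N₂, ‖∑ m ∈ S', k n m * ∑ Q ∈ 𝒬, b Q m‖
          ≤ ∑ n ∈ N₂, ∑ Q ∈ 𝒬, ‖∑ m ∈ dyadicCube Q.1 Q.2, k n m * b Q m‖ := by
            refine Finset.sum_le_sum fun n _ => ?_
            simp only [Finset.mul_sum]
            rw [Finset.sum_comm]
            refine (norm_sum_le _ _).trans_eq (Finset.sum_congr rfl fun Q hQ => ?_)
            rw [eb Q hQ]
        _ = ∑ Q ∈ 𝒬, ∑ n ∈ N₂, ‖∑ m ∈ dyadicCube Q.1 Q.2, k n m * b Q m‖ := Finset.sum_comm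
        _ ≤ ∑ Q ∈ 𝒬, D * ∑ m ∈ dyadicCube Q.1 Q.2, ‖b Q m‖ := by
            refine Finset.sum_le_sum fun Q hQ =>
              hk.sum_norm_le hC Q.1 Q.2 (b Q) (hbzero Q) N₂ fun n hn => ?_
            by_contra! hlt
            exact (Finset.mem_filter.mp hn).2 ⟨Q, hQ, hlt⟩
        _ ≤ _ := by rw [← Finset.mul_sum]; gcongr
    linarith
  have hsplit := card_filter_lt_norm_add_le N₂ (fun n => ∑ m ∈ S', k n m * g m)
    (fun n => ∑ m ∈ S', k n m * ∑ Q ∈ 𝒬, b Q m) (fun n => ∑ m ∈ S, k n m * f m) (fun n _ => by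
      simp only [eT' n, ← Finset.sum_add_distrib]
      exact Finset.sum_congr rfl fun m _ => by rw [hfgb m]; ring) t
  have hcount : ((N.filter fun n => t < ‖∑ m ∈ S, k n m * f m‖).card : ℝ) ≤
      N₁.card + ((N₂.filter fun n => t < ‖∑ m ∈ S, k n m * f m‖).card : ℝ) := by
    norm_cast
    refine (Finset.card_le_card fun n hn => ?_).trans (Finset.card_union_le _ _)
    rw [Finset.mem_filter] at hn
    by_cases h : near n
    · exact Finset.mem_union_left _ (Finset.mem_filter.mpr ⟨hn.1, h⟩)
    · exact Finset.mem_union_right _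
        (Finset.mem_filter.mpr ⟨Finset.mem_filter.mpr ⟨hn.1, h⟩, hn.2⟩)
  have hfin := mul_le_mul_of_nonneg_left (hcount.trans (add_le_add_right hsplit _)) ht.le
  simp only [mul_add] at hfin
  linarith

/-- A matrix that is bounded on `ℓ²` and regular in both variables is bounded on `ℓ^p`. -/
theorem RegularMatrix.exists_matrixBound (hd : d ≠ 0) {k : (Fin d → ℤ) → (Fin d → ℤ) → ℂ}
    {B C : ℝ} (hB : 0 ≤ B) (hC : 0 ≤ C) (hk : RegularMatrix k C)
    (hk' : RegularMatrix (fun n m => k m n) C) (h2 : MatrixBound k 2 B) {p : ℝ} (hp : 1 < p) :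
    ∃ D, 0 ≤ D ∧ MatrixBound k p D := by
  have hW := latticeTailSum_nonneg (d := d)
  have main : ∀ (l : (Fin d → ℤ) → (Fin d → ℤ) → ℂ) (B' q : ℝ), 0 ≤ B' → 1 < q → q < 2 →
      RegularMatrix l C → MatrixBound l 2 B' → ∃ D, 0 ≤ D ∧ MatrixBound l q D := by
    intro l B' q hB' hq1 hq2 hl hl2
    refine ⟨_, ?_, MatrixBound.of_weak_of_two ?_ hB' (hl.weakMatrixBound hd hB' hC hl2) hl2 hq1 hq2⟩
    · have h1 : 0 < q - 1 := by linarith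
      have h2 : 0 < 2 - q := by linarith
      positivity
    · positivity
  rcases lt_trichotomy p 2 with hlt | rfl | hgt
  · exact main k B p hB hp hlt hk h2
  · exact ⟨B, hB, h2⟩
  -- For `p > 2` the case already treated is applied to the transpose at the conjugate exponent `q <
  -- 2`, and the result is transposed back.
  · have hpq := Real.HolderConjugate.conjExponent hp
    set q := p.conjExponent with hq
    have hq2 : q < 2 := by
      rw [hq, Real.conjExponent, div_lt_iff₀ (by linarith)]
      linarith
    obtain ⟨D, hD, hDb⟩ := main _ _ q (by positivity) hpq.symm.lt hq2 hk'
      (h2.transpose Real.HolderConjugate.two_two hB)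
    exact ⟨_, by positivity, hDb.transpose hpq.symm hD⟩

end WeakTypeBound

/-! ### Sup norm on `ℤ^d` against the Euclidean norm. -/

section LatticePoints

variable {d : ℕ}

theorem latticePoint_zero : latticePoint (0 : Fin d → ℤ) = 0 := by
  ext i; simp [latticePoint]

theorem latticePoint_sub (n m : Fin d → ℤ) :
    latticePoint n - latticePoint m = latticePoint (n - m) := by
  ext i; simp [latticePoint]

theorem norm_le_norm_latticePoint (q : Fin d → ℤ) : ‖q‖ ≤ ‖latticePoint q‖ := by
  rw [pi_norm_le_iff_of_nonneg (norm_nonneg _)]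
  intro i
  have := PiLp.norm_apply_le (latticePoint q) i
  rw [Int.norm_eq_abs]
  simpa [latticePoint] using this

theorem norm_latticePoint_le (q : Fin d → ℤ) : ‖latticePoint q‖ ≤ d * ‖q‖ := by
  rw [EuclideanSpace.norm_eq]
  refine Real.sqrt_le_iff.mpr ⟨by positivity, ?_⟩
  calc ∑ i, ‖(latticePoint q) i‖ ^ 2 ≤ ∑ _i : Fin d, ‖q‖ ^ 2 := by
        refine Finset.sum_le_sum fun i _ => ?_
        have : ‖(latticePoint q) i‖ = ‖q i‖ := by
          rw [Int.norm_eq_abs]; simp [latticePoint]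
        rw [this]
        gcongr
        exact norm_le_pi_norm q i
    _ = d * ‖q‖ ^ 2 := by simp
    _ ≤ (d * ‖q‖) ^ 2 := by
        rw [mul_pow]
        gcongr
        exact_mod_cast Nat.le_self_pow two_ne_zero d

theorem norm_sub_le_dist_latticePoint (n m : Fin d → ℤ) :
    ‖n - m‖ ≤ ‖latticePoint n - latticePoint m‖ := by
  rw [latticePoint_sub]; exact norm_le_norm_latticePoint _

theorem one_le_dist_latticePoint {n m : Fin d → ℤ} (h : n ≠ m) :
    1 ≤ ‖latticePoint n - latticePoint m‖ :=
  (one_le_norm_lattice (sub_ne_zero.mpr h)).trans (norm_sub_le_dist_latticePoint n m)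

end LatticePoints

/-! ### From gradient bounds to regular matrices. -/

section SmoothKernels

variable {d : ℕ}

local notation "ℰ" => EuclideanSpace ℝ (Fin d)

/-- A `C¹` kernel off the diagonal with the gradient bound of a Calderón–Zygmund kernel. -/
structure IsSmoothKernel (K : EuclideanSpace ℝ (Fin d) → EuclideanSpace ℝ (Fin d) → ℂ)
    (C : ℝ) : Prop where
  nonneg : 0 ≤ C
  contDiffOn : ContDiffOn ℝ 1 (fun z : EuclideanSpace ℝ (Fin d) × EuclideanSpace ℝ (Fin d) =>
    K z.1 z.2) {z | z.1 ≠ z.2}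
  bound : ∀ x y, x ≠ y →
    ‖fderiv ℝ (fun x' => K x' y) x‖ + ‖fderiv ℝ (fun y' => K x y') y‖ ≤ C / ‖x - y‖ ^ (d + 1)

variable {K : EuclideanSpace ℝ (Fin d) → EuclideanSpace ℝ (Fin d) → ℂ} {C : ℝ}

theorem IsSmoothKernel.swap (h : IsSmoothKernel K C) : IsSmoothKernel (fun x y => K y x) C where
  nonneg := h.nonneg
  contDiffOn := h.contDiffOn.comp (t := {z : ℰ × ℰ | z.1 ≠ z.2}) (f := Prod.swap)
    (contDiff_snd.prodMk contDiff_fst).contDiffOn fun _ hz => Ne.symm hz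
  bound x y hxy := by
    have := h.bound y x hxy.symm
    rw [norm_sub_rev y x] at this
    linarith

theorem IsSmoothKernel.differentiableAt_snd (h : IsSmoothKernel K C) {x y : ℰ} (hxy : x ≠ y) :
    DifferentiableAt ℝ (fun y' => K x y') y := by
  have ho : IsOpen {z : ℰ × ℰ | z.1 ≠ z.2} := isOpen_ne_fun continuous_fst continuous_snd
  have h1 : DifferentiableAt ℝ (fun z : ℰ × ℰ => K z.1 z.2) (x, y) :=
    (h.contDiffOn.differentiableOn one_ne_zero).differentiableAt (ho.mem_nhds hxy)
  exact h1.comp y (f := fun y' => (x, y')) (by fun_prop)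

/-- Mean value inequality on the ball about `y` of radius `‖y' - y‖`, which keeps distance `‖x - y‖
/ 2` from `x`; halving the distance costs `2 ^ (d + 1)`. -/
theorem IsSmoothKernel.norm_sub_le (h : IsSmoothKernel K C) {x y y' : ℰ} (hxy : x ≠ y)
    (hy : 2 * ‖y' - y‖ ≤ ‖x - y‖) :
    ‖K x y' - K x y‖ ≤ C * 2 ^ (d + 1) / ‖x - y‖ ^ (d + 1) * ‖y' - y‖ := by
  have hpos : 0 < ‖x - y‖ := norm_pos_iff.mpr (sub_ne_zero.mpr hxy)
  have hfar : ∀ z ∈ Metric.closedBall y ‖y' - y‖, ‖x - y‖ / 2 ≤ ‖x - z‖ := by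
    intro z hz
    rw [mem_closedBall_iff_norm] at hz
    have := norm_sub_le_norm_sub_add_norm_sub x z y
    linarith
  have hne : ∀ z ∈ Metric.closedBall y ‖y' - y‖, x ≠ z := by
    intro z hz he
    have := hfar z hz
    rw [he, sub_self, norm_zero] at this
    rw [← he] at this
    linarith
  refine (convex_closedBall y ‖y' - y‖).norm_image_sub_le_of_norm_fderiv_le (𝕜 := ℝ)
    (f := fun y' => K x y') (fun z hz => h.differentiableAt_snd (hne z hz)) (fun z hz => ?_)
    (Metric.mem_closedBall_self (norm_nonneg _)) (mem_closedBall_iff_norm.mpr le_rfl)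
  have h1 := h.bound x z (hne z hz)
  have h2 : C / ‖x - z‖ ^ (d + 1) ≤ C / (‖x - y‖ / 2) ^ (d + 1) := by
    have := h.nonneg
    gcongr
    exact hfar z hz
  have h3 : C / (‖x - y‖ / 2) ^ (d + 1) = C * 2 ^ (d + 1) / ‖x - y‖ ^ (d + 1) := by
    rw [div_pow]; field_simp
  linarith [norm_nonneg (fderiv ℝ (fun x' => K x' z) x)]

/-- The matrix of the discrete analogue, with zero diagonal. -/
noncomputable def latticeMatrix (K : EuclideanSpace ℝ (Fin d) → EuclideanSpace ℝ (Fin d) → ℂ)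
    (n m : Fin d → ℤ) : ℂ :=
  open Classical in if n = m then 0 else K (latticePoint n) (latticePoint m)

theorem latticeMatrix_self (n : Fin d → ℤ) : latticeMatrix K n n = 0 := if_pos rfl

theorem latticeMatrix_of_ne {n m : Fin d → ℤ} (h : n ≠ m) :
    latticeMatrix K n m = K (latticePoint n) (latticePoint m) := if_neg h

theorem latticeMatrix_swap :
    latticeMatrix (fun x y => K y x) = fun n m => latticeMatrix K m n := by
  ext n m
  rcases eq_or_ne n m with rfl | h
  · simp only [latticeMatrix_self]
  · rw [latticeMatrix_of_ne h, latticeMatrix_of_ne h.symm]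

theorem IsSmoothKernel.regularMatrix (hd : d ≠ 0) (h : IsSmoothKernel K C) :
    RegularMatrix (latticeMatrix K) (C * 2 ^ (d + 1) * d) := by
  intro n m c hnc hmc
  have hC := h.nonneg
  have hd0 : (1 : ℝ) ≤ d := by exact_mod_cast Nat.one_le_iff_ne_zero.mpr hd
  have hpos : 0 < ‖n - c‖ := norm_pos_iff.mpr (sub_ne_zero.mpr hnc)
  have hnm : n ≠ m := by
    rintro rfl
    nlinarith
  rw [latticeMatrix_of_ne hnc, latticeMatrix_of_ne hnm]
  have h1 : ‖latticePoint m - latticePoint c‖ ≤ d * ‖m - c‖ := by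
    rw [latticePoint_sub]; exact norm_latticePoint_le _
  have h2 := norm_sub_le_dist_latticePoint n c
  have h3 : latticePoint n ≠ latticePoint c := fun e => by
    rw [e, sub_self, norm_zero] at h2
    linarith
  -- The factor `2 * d` in `RegularMatrix` pays for the loss `d` in the norm comparison and the `2`
  -- required here.
  refine (h.norm_sub_le h3 (by linarith)).trans ?_
  calc _ ≤ C * 2 ^ (d + 1) / ‖n - c‖ ^ (d + 1) * (d * ‖m - c‖) := by gcongr
    _ = _ := by ring

end SmoothKernels

/-! ### Orthonormal bumps at the lattice points. -/

section LatticeBumps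

variable {d : ℕ}

local notation "ℰ" => EuclideanSpace ℝ (Fin d)

/-- A smooth bump on the ball of radius `1 / 4` around a lattice point. -/
noncomputable def latticeBump (n : Fin d → ℤ) (x : EuclideanSpace ℝ (Fin d)) : ℝ :=
  (⟨1 / 8, 1 / 4, by norm_num, by norm_num⟩ : ContDiffBump (0 : EuclideanSpace ℝ (Fin d)))
    (x - latticePoint n)

theorem latticeBump_nonneg (n : Fin d → ℤ) (x : ℰ) : 0 ≤ latticeBump n x :=
  ContDiffBump.nonneg _

theorem latticeBump_eq_zero {n : Fin d → ℤ} {x : ℰ} (h : 1 / 4 ≤ ‖x - latticePoint n‖) :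
    latticeBump n x = 0 :=
  ContDiffBump.zero_of_le_dist _ (by simpa using h)

theorem contDiff_latticeBump (n : Fin d → ℤ) : ContDiff ℝ ((⊤ : ℕ∞) : WithTop ℕ∞)
    (latticeBump n) :=
  (ContDiffBump.contDiff _).comp (contDiff_id.sub contDiff_const)

theorem continuous_latticeBump (n : Fin d → ℤ) : Continuous (latticeBump n) :=
  (contDiff_latticeBump n).continuous

theorem hasCompactSupport_latticeBump (n : Fin d → ℤ) : HasCompactSupport (latticeBump n) :=
  HasCompactSupport.intro (isCompact_closedBall (latticePoint n) (1 / 4)) fun x hx =>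
    latticeBump_eq_zero (by
      rw [mem_closedBall_iff_norm, not_le] at hx
      exact hx.le)

theorem integrable_latticeBump (n : Fin d → ℤ) : Integrable (latticeBump n) :=
  (continuous_latticeBump n).integrable_of_hasCompactSupport (hasCompactSupport_latticeBump n)

/-- The integral of the bump functions. -/
noncomputable def bumpMass (d : ℕ) : ℝ := ∫ x, latticeBump (0 : Fin d → ℤ) x

theorem integral_latticeBump (n : Fin d → ℤ) : ∫ x, latticeBump n x = bumpMass d := by
  simp only [bumpMass, latticeBump]
  rw [integral_sub_right_eq_self (fun x => ContDiffBump.toFun _ x),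
    integral_sub_right_eq_self (fun x => ContDiffBump.toFun _ x)]

theorem bumpMass_pos : 0 < bumpMass d := by
  simp only [bumpMass, latticeBump]
  rw [integral_sub_right_eq_self (fun x => ContDiffBump.toFun _ x)]
  exact ContDiffBump.integral_pos _

/-- The bump at a lattice point as a complex Schwartz function. -/
noncomputable def schwartzBump (n : Fin d → ℤ) : 𝓢(EuclideanSpace ℝ (Fin d), ℂ) :=
  HasCompactSupport.toSchwartzMap (f := fun x => (latticeBump n x : ℂ))
    ((hasCompactSupport_latticeBump n).comp_left Complex.ofReal_zero)
    (Complex.ofRealCLM.contDiff.comp (contDiff_latticeBump n))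

theorem schwartzBump_apply (n : Fin d → ℤ) (x : ℰ) :
    schwartzBump n x = (latticeBump n x : ℂ) := rfl

/-- Distinct lattice points are at distance at least `1`, so balls of radius `1 / 4` around them are
disjoint. -/
theorem latticeBump_mul_eq_zero {n m : Fin d → ℤ} (h : n ≠ m) (x : ℰ) :
    latticeBump n x * latticeBump m x = 0 := by
  by_cases hx : 1 / 4 ≤ ‖x - latticePoint n‖
  · rw [latticeBump_eq_zero hx, zero_mul]
  · rw [latticeBump_eq_zero (n := m), mul_zero]
    have h1 := one_le_dist_latticePoint h
    have h2 := norm_sub_le_norm_sub_add_norm_sub (latticePoint n) x (latticePoint m)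
    rw [norm_sub_rev (latticePoint n) x] at h2
    linarith

/-- The common `L²` norm of the bump functions. -/
noncomputable def bumpNorm (d : ℕ) : ℝ := ‖(schwartzBump (0 : Fin d → ℤ)).toLp 2 volume‖

theorem norm_schwartzBump_toLp (n : Fin d → ℤ) : ‖(schwartzBump n).toLp 2 volume‖ = bumpNorm d := by
  rw [bumpNorm, SchwartzMap.norm_toLp, SchwartzMap.norm_toLp]
  congr 1
  have h := eLpNorm_comp_measurePreserving (p := 2)
    ((schwartzBump (0 : Fin d → ℤ)).continuous.aestronglyMeasurable)
    (measurePreserving_sub_right volume (latticePoint n))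
  rw [← h]
  congr 1
  ext x
  simp only [Function.comp_apply, schwartzBump_apply, latticeBump, latticePoint_zero, sub_zero]

theorem bumpNorm_pos : 0 < bumpNorm d := by
  refine norm_pos_iff.mpr fun h => ?_
  have h0 : schwartzBump (0 : Fin d → ℤ) = 0 := by
    refine SchwartzMap.injective_toLp 2 volume ?_
    simp only [h]
    exact ((SchwartzMap.toLpCLM ℂ ℂ 2 (volume : Measure ℰ)).map_zero).symm
  have h1 := integral_latticeBump (0 : Fin d → ℤ)
  have h2 : ∀ x, latticeBump (0 : Fin d → ℤ) x = 0 := fun x => by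
    have := DFunLike.congr_fun h0 x
    rw [schwartzBump_apply] at this
    exact Complex.ofReal_eq_zero.mp this
  simp only [h2, integral_zero] at h1
  exact bumpMass_pos.ne h1

theorem inner_schwartzBump_toLp {u : ℰ → ℂ}
    (hu : MemLp u 2 volume) (n : Fin d → ℤ) :
    inner ℂ ((schwartzBump n).toLp 2 volume) (hu.toLp u) = ∫ x, (latticeBump n x : ℂ) * u x := by
  rw [L2.inner_def]
  refine integral_congr_ae ?_
  filter_upwards [(schwartzBump n).coeFn_toLp 2 volume, hu.coeFn_toLp] with x h1 h2
  rw [h1, h2, schwartzBump_apply, RCLike.inner_apply, Complex.conj_ofReal, mul_comm]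

/-- The bump functions, normalized in `L²`. -/
noncomputable def normalizedBump (n : Fin d → ℤ) :
    Lp ℂ 2 (volume : Measure (EuclideanSpace ℝ (Fin d))) :=
  ((bumpNorm d)⁻¹ : ℂ) • (schwartzBump n).toLp 2 volume

theorem orthonormal_normalizedBump : Orthonormal ℂ (normalizedBump (d := d)) := by
  have hc := bumpNorm_pos (d := d)
  refine ⟨fun n => ?_, fun n m hnm => ?_⟩
  · rw [normalizedBump, norm_smul, norm_schwartzBump_toLp, norm_inv, Complex.norm_real,
      Real.norm_of_nonneg hc.le, inv_mul_cancel₀ hc.ne']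
  · simp only [normalizedBump]
    rw [inner_smul_left, inner_smul_right]
    have : inner ℂ ((schwartzBump n).toLp 2 volume) ((schwartzBump m).toLp 2 volume) = 0 := by
      refine (inner_schwartzBump_toLp ((schwartzBump m).memLp 2 volume) n).trans ?_
      refine integral_eq_zero_of_ae (ae_of_all _ fun x => ?_)
      simp only [schwartzBump_apply, ← Complex.ofReal_mul, latticeBump_mul_eq_zero hnm,
        Complex.ofReal_zero, Pi.zero_apply]
    rw [this]
    simp

end LatticeBumps

/-! ### Sampling the operator on bumps; the `ℓ²` bound. -/

section Sampling

variable {d : ℕ}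

local notation "ℰ" => EuclideanSpace ℝ (Fin d)

/-- The matrix entries of an operator against the bump functions. -/
noncomputable def bumpMatrix
    (T : 𝓢(EuclideanSpace ℝ (Fin d), ℂ) →ₗ[ℂ] (EuclideanSpace ℝ (Fin d) → ℂ))
    (n m : Fin d → ℤ) : ℂ :=
  ∫ x, (latticeBump n x : ℂ) * T (schwartzBump m) x

theorem integrable_latticeBump_mul {u : ℰ → ℂ} (hu : MemLp u 2 volume) (n : Fin d → ℤ) :
    Integrable fun x => (latticeBump n x : ℂ) * u x :=
  MemLp.integrable_mul ((schwartzBump n).memLp 2 volume) hu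

theorem norm_toLp_sum_schwartzBump_sq (S : Finset (Fin d → ℤ)) (f : (Fin d → ℤ) → ℂ) :
    ‖(∑ m ∈ S, f m • schwartzBump m).toLp 2 volume‖ ^ 2 =
      bumpNorm d ^ 2 * ∑ m ∈ S, ‖f m‖ ^ 2 := by
  have hc := bumpNorm_pos (d := d)
  have hc' : (bumpNorm d : ℂ) ≠ 0 := by exact_mod_cast hc.ne'
  have e : (∑ m ∈ S, f m • schwartzBump m).toLp 2 volume =
      (bumpNorm d : ℂ) • ∑ m ∈ S, f m • normalizedBump m := by
    change SchwartzMap.toLpCLM ℂ ℂ 2 (volume : Measure ℰ) _ = _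
    rw [map_sum, Finset.smul_sum]
    refine Finset.sum_congr rfl fun m _ => ?_
    rw [map_smul, normalizedBump, smul_comm (bumpNorm d : ℂ), smul_smul (bumpNorm d : ℂ),
      mul_inv_cancel₀ hc', one_smul]
    rfl
  have h := orthonormal_normalizedBump.inner_sum f f S
  rw [inner_self_eq_norm_sq_to_K] at h
  have h' : ‖∑ m ∈ S, f m • normalizedBump m‖ ^ 2 = ∑ m ∈ S, ‖f m‖ ^ 2 := by
    simp only [Complex.conj_mul'] at h
    refine Complex.ofReal_injective ?_
    push_cast
    exact h
  rw [e, norm_smul, mul_pow, h', Complex.norm_real, Real.norm_of_nonneg hc.le]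

/-- `T` is applied to `∑ f m • schwartzBump m`, whose `L²` norm is `bumpNorm d` times the `ℓ²` norm
of `f`; Bessel's inequality bounds the coefficients of the image. -/
theorem bumpMatrix_bound
    (T : 𝓢(EuclideanSpace ℝ (Fin d), ℂ) →ₗ[ℂ] (EuclideanSpace ℝ (Fin d) → ℂ)) (C : ℝ≥0)
    (hT : ∀ f : 𝓢(EuclideanSpace ℝ (Fin d), ℂ),
      MemLp (T f) 2 volume ∧ eLpNorm (T f) 2 volume ≤ C * eLpNorm f 2 volume) :
    MatrixBound (bumpMatrix T) 2 ((C * bumpNorm d ^ 2) ^ 2) := by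
  intro S N f
  have hc := bumpNorm_pos (d := d)
  simp only [Real.rpow_two]
  set F := ∑ m ∈ S, f m • schwartzBump m with hF
  have hu := (hT F).1
  have e1 : ∀ n, ∑ m ∈ S, bumpMatrix T n m * f m =
      bumpNorm d * inner ℂ (normalizedBump n) (hu.toLp (T F)) := by
    intro n
    rw [normalizedBump, inner_smul_left, inner_schwartzBump_toLp hu, ← mul_assoc, map_inv₀,
      Complex.conj_ofReal, mul_inv_cancel₀ (by exact_mod_cast hc.ne'), one_mul]
    have e2 : ∀ x, (latticeBump n x : ℂ) * T F x =
        ∑ m ∈ S, (latticeBump n x : ℂ) * T (schwartzBump m) x * f m := by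
      intro x
      rw [hF, map_sum, Finset.sum_apply, Finset.mul_sum]
      refine Finset.sum_congr rfl fun m _ => ?_
      rw [map_smul, Pi.smul_apply, smul_eq_mul]
      ring
    simp only [e2]
    rw [integral_finsetSum _ fun m _ =>
      (integrable_latticeBump_mul (hT (schwartzBump m)).1 n).mul_const _]
    simp only [integral_mul_const, bumpMatrix]
  have e3 : ‖hu.toLp (T F)‖ ≤ C * ‖F.toLp 2 volume‖ := by
    rw [Lp.norm_toLp, SchwartzMap.norm_toLp]
    have h := ENNReal.toReal_mono (ENNReal.mul_ne_top ENNReal.coe_ne_top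
      (F.memLp 2 volume).eLpNorm_ne_top) (hT F).2
    rwa [ENNReal.toReal_mul, ENNReal.coe_toReal] at h
  calc ∑ n ∈ N, ‖∑ m ∈ S, bumpMatrix T n m * f m‖ ^ 2
      = bumpNorm d ^ 2 * ∑ n ∈ N, ‖inner ℂ (normalizedBump n) (hu.toLp (T F))‖ ^ 2 := by
        rw [Finset.mul_sum]
        refine Finset.sum_congr rfl fun n _ => ?_
        rw [e1, norm_mul, mul_pow, Complex.norm_real, Real.norm_of_nonneg hc.le]
    _ ≤ bumpNorm d ^ 2 * ‖hu.toLp (T F)‖ ^ 2 := by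
        gcongr
        exact orthonormal_normalizedBump.sum_inner_products_le _
    _ ≤ bumpNorm d ^ 2 * (C * ‖F.toLp 2 volume‖) ^ 2 := by gcongr
    _ = _ := by
        rw [mul_pow, hF, norm_toLp_sum_schwartzBump_sq]
        ring

variable {K : EuclideanSpace ℝ (Fin d) → EuclideanSpace ℝ (Fin d) → ℂ} {C : ℝ}

/-- One variable is moved at a time, the first through `IsSmoothKernel.swap`. All distances that
occur are at least `‖n - m‖ / 2`, and each move, of length at most `1 / 4`, costs a quarter of the
bound. -/
theorem IsSmoothKernel.norm_sub_le_near_lattice (h : IsSmoothKernel K C) {n m : Fin d → ℤ}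
    (hnm : n ≠ m) {x y : ℰ} (hx : ‖x - latticePoint n‖ ≤ 1 / 4)
    (hy : ‖y - latticePoint m‖ ≤ 1 / 4) :
    ‖K x y - K (latticePoint n) (latticePoint m)‖ ≤ C * 4 ^ (d + 1) * (‖n - m‖⁻¹) ^ (d + 1) := by
  have hC := h.nonneg
  set a := latticePoint n
  set b := latticePoint m
  have h1 : 1 ≤ ‖a - b‖ := one_le_dist_latticePoint hnm
  have h2 : ‖a - b‖ ≤ ‖x - a‖ + ‖x - b‖ := by
    rw [norm_sub_rev x a]; exact norm_sub_le_norm_sub_add_norm_sub a x b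
  have hxb : x ≠ b := fun e => by
    rw [e, sub_self, norm_zero] at h2
    rw [e] at hx
    linarith
  have hab : a ≠ b := fun e => by
    rw [e, sub_self, norm_zero] at h1
    linarith
  have i1 := h.norm_sub_le hxb (y' := y) (by linarith)
  have i2 := h.swap.norm_sub_le (x := b) (y := a) (y' := x) hab.symm (by
    rw [norm_sub_rev b a]; linarith)
  rw [norm_sub_rev b a] at i2
  have hr : 1 ≤ ‖n - m‖ := one_le_norm_lattice (sub_ne_zero.mpr hnm)
  have hra : ‖n - m‖ ≤ ‖a - b‖ := norm_sub_le_dist_latticePoint n m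
  have j1 : C * 2 ^ (d + 1) / ‖x - b‖ ^ (d + 1) * ‖y - b‖ ≤
      C * 2 ^ (d + 1) / (‖n - m‖ / 2) ^ (d + 1) * (1 / 4) := by
    gcongr
    linarith
  have j2 : C * 2 ^ (d + 1) / ‖a - b‖ ^ (d + 1) * ‖x - a‖ ≤
      C * 2 ^ (d + 1) / (‖n - m‖ / 2) ^ (d + 1) * (1 / 4) := by
    gcongr
    linarith
  have e : C * 2 ^ (d + 1) / (‖n - m‖ / 2) ^ (d + 1) =
      C * 4 ^ (d + 1) * (‖n - m‖⁻¹) ^ (d + 1) := by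
    rw [div_pow, inv_pow, show (4 : ℝ) = 2 * 2 by norm_num, mul_pow]
    field_simp
  have h0 : 0 ≤ C * 4 ^ (d + 1) * (‖n - m‖⁻¹) ^ (d + 1) := by positivity
  rw [e] at j1 j2
  calc ‖K x y - K a b‖ ≤ ‖K x y - K x b‖ + ‖K x b - K a b‖ :=
        norm_sub_le_norm_sub_add_norm_sub _ _ _
    _ ≤ _ := by linarith

theorem IsSmoothKernel.integrable_mul_latticeBump (h : IsSmoothKernel K C) {m : Fin d → ℤ} {x : ℰ}
    (hx : 1 / 4 < ‖x - latticePoint m‖) :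
    Integrable fun y => K x y * (latticeBump m y : ℂ) := by
  have h1 : IntegrableOn (fun y => K x y * (latticeBump m y : ℂ))
      (Metric.closedBall (latticePoint m) (1 / 4)) := by
    refine ContinuousOn.integrableOn_compact (isCompact_closedBall _ _) ?_
    refine ContinuousOn.mul (fun y hy => ?_)
      (Complex.continuous_ofReal.comp (continuous_latticeBump m)).continuousOn
    refine (h.differentiableAt_snd ?_).continuousAt.continuousWithinAt
    rintro rfl
    rw [mem_closedBall_iff_norm] at hy
    linarith
  refine (integrableOn_iff_integrable_of_support_subset fun y hy => ?_).mp h1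
  rw [mem_closedBall_iff_norm]
  by_contra! hlt
  exact hy (by simp [latticeBump_eq_zero hlt.le])

/-- The support of the bump stays at distance `1 / 2` from `x`, so truncation at `ε < 1 / 2` removes
nothing. -/
theorem principalValue_schwartzBump {m : Fin d → ℤ} {x : ℰ} (hx : 3 / 4 ≤ ‖x - latticePoint m‖)
    {L : ℂ} (hL : Tendsto (fun ε : ℝ => ∫ y in {y | ε < ‖x - y‖}, K x y * schwartzBump m y)
      (𝓝[>] 0) (𝓝 L)) :
    L = ∫ y, K x y * (latticeBump m y : ℂ) := by
  refine tendsto_nhds_unique (hL.congr' ?_) tendsto_const_nhds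
  filter_upwards [Ioo_mem_nhdsGT (show (0 : ℝ) < 1 / 2 by norm_num)] with ε hε
  refine setIntegral_eq_integral_of_forall_compl_eq_zero fun y hy => ?_
  have hy' : ‖x - y‖ ≤ ε := not_lt.mp hy
  rw [schwartzBump_apply, latticeBump_eq_zero, Complex.ofReal_zero, mul_zero]
  have := norm_sub_le_norm_sub_add_norm_sub x y (latticePoint m)
  linarith [hε.2]

theorem IsSmoothKernel.norm_bumpMatrix_sub_le (h : IsSmoothKernel K C)
    {T : 𝓢(EuclideanSpace ℝ (Fin d), ℂ) →ₗ[ℂ] (EuclideanSpace ℝ (Fin d) → ℂ)}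
    (hT : IsCalderonZygmund T K) {n m : Fin d → ℤ} (hnm : n ≠ m) :
    ‖bumpMatrix T n m - bumpMass d ^ 2 * K (latticePoint n) (latticePoint m)‖ ≤
      bumpMass d ^ 2 * (C * 4 ^ (d + 1) * (‖n - m‖⁻¹) ^ (d + 1)) := by
  set R := C * 4 ^ (d + 1) * (‖n - m‖⁻¹) ^ (d + 1) with hR
  set K₀ := K (latticePoint n) (latticePoint m) with hK₀
  have hc := bumpMass_pos (d := d)
  have hmem : MemLp (T (schwartzBump m)) 2 volume :=
    (hT.bounded_L2.choose_spec (schwartzBump m)).1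
  have hintC : ∀ l : Fin d → ℤ, ∫ y, (latticeBump l y : ℂ) = bumpMass d := fun l => by
    rw [integral_complex_ofReal, integral_latticeBump]
  have hiC : ∀ l : Fin d → ℤ, Integrable fun y => (latticeBump l y : ℂ) := fun l =>
    (integrable_latticeBump l).ofReal
  -- The kernel formula holds only almost everywhere, which suffices since `x` is integrated against
  -- the bump at `n`.
  have inner_bound : ∀ᵐ x : ℰ, ‖x - latticePoint n‖ < 1 / 4 →
      ‖T (schwartzBump m) x - bumpMass d * K₀‖ ≤ bumpMass d * R := by
    filter_upwards [hT.principal_value (schwartzBump m)] with x hx hxn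
    have h1 := one_le_dist_latticePoint hnm
    have h2 := norm_sub_le_norm_sub_add_norm_sub (latticePoint n) x (latticePoint m)
    rw [norm_sub_rev (latticePoint n) x] at h2
    have hxm : 3 / 4 ≤ ‖x - latticePoint m‖ := by linarith
    rw [principalValue_schwartzBump hxm hx]
    have e : ∫ y, K x y * (latticeBump m y : ℂ) - K₀ * (latticeBump m y : ℂ) =
        (∫ y, K x y * (latticeBump m y : ℂ)) - bumpMass d * K₀ := by
      rw [integral_sub (h.integrable_mul_latticeBump (by linarith)) ((hiC m).const_mul _),
        integral_const_mul, hintC, mul_comm K₀]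
    rw [← e, ← integral_latticeBump m, ← integral_mul_const]
    refine norm_integral_le_of_norm_le ((integrable_latticeBump m).mul_const R)
      (ae_of_all _ fun y => ?_)
    rw [← sub_mul, norm_mul, Complex.norm_real, Real.norm_of_nonneg (latticeBump_nonneg m y),
      mul_comm]
    rcases le_or_gt (1 / 4) ‖y - latticePoint m‖ with hy | hy
    · simp [latticeBump_eq_zero hy]
    · exact mul_le_mul_of_nonneg_left (h.norm_sub_le_near_lattice hnm hxn.le hy.le)
        (latticeBump_nonneg m y)
  have e : ∫ x, (latticeBump n x : ℂ) * T (schwartzBump m) x -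
      (latticeBump n x : ℂ) * (bumpMass d * K₀) = bumpMatrix T n m - bumpMass d ^ 2 * K₀ := by
    rw [integral_sub (integrable_latticeBump_mul hmem n) ((hiC n).mul_const _),
      integral_mul_const, hintC, bumpMatrix]
    ring
  have e' : bumpMass d ^ 2 * R = ∫ x, latticeBump n x * (bumpMass d * R) := by
    rw [integral_mul_const, integral_latticeBump]
    ring
  rw [← e, e']
  refine norm_integral_le_of_norm_le ((integrable_latticeBump n).mul_const _) ?_
  filter_upwards [inner_bound] with x hx
  rw [← mul_sub, norm_mul, Complex.norm_real, Real.norm_of_nonneg (latticeBump_nonneg n x)]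
  rcases le_or_gt (1 / 4) ‖x - latticePoint n‖ with hxn | hxn
  · simp [latticeBump_eq_zero hxn]
  · exact mul_le_mul_of_nonneg_left (hx hxn) (latticeBump_nonneg n x)

/-- Serves for the diagonal of `bumpMatrix`, about which the off-diagonal comparison with `K` says
nothing. -/
theorem MatrixBound.norm_entry_le {ι : Type*} {k : ι → ι → ℂ} {B : ℝ} (h : MatrixBound k 2 (B ^ 2))
    (hB : 0 ≤ B) (n m : ι) : ‖k n m‖ ≤ B := by
  have := h {m} {n} 1
  simp only [Finset.sum_singleton, Pi.one_apply, mul_one, norm_one, Real.rpow_two,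
    one_pow] at this
  exact (pow_le_pow_iff_left₀ (norm_nonneg _) hB two_ne_zero).mp this

theorem MatrixBound.const_mul {ι : Type*} {k : ι → ι → ℂ} {B : ℝ} (h : MatrixBound k 2 B)
    (a : ℂ) : MatrixBound (fun n m => a * k n m) 2 (‖a‖ ^ 2 * B) := by
  intro S N f
  have h1 := h S N f
  simp only [Real.rpow_two, mul_assoc, ← Finset.mul_sum, norm_mul, mul_pow] at h1 ⊢
  gcongr

/-- The discrete analogue of a Calderón–Zygmund operator is bounded on `ℓ²`. -/
theorem IsSmoothKernel.exists_matrixBound_two (h : IsSmoothKernel K C)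
    {T : 𝓢(EuclideanSpace ℝ (Fin d), ℂ) →ₗ[ℂ] (EuclideanSpace ℝ (Fin d) → ℂ)}
    (hT : IsCalderonZygmund T K) :
    ∃ B, 0 ≤ B ∧ MatrixBound (latticeMatrix K) 2 B := by
  classical
  have hC := h.nonneg
  have hc := bumpMass_pos (d := d)
  have hcC : (bumpMass d : ℂ) ≠ 0 := by exact_mod_cast hc.ne'
  obtain ⟨A, hA⟩ := hT.bounded_L2
  have hM := bumpMatrix_bound T A hA
  set B := A * bumpNorm d ^ 2 with hB
  have hB0 : 0 ≤ B := by positivity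
  set a : ℂ := ((bumpMass d : ℂ) ^ 2)⁻¹ with ha
  have hna : ‖a‖ = (bumpMass d ^ 2)⁻¹ := by
    rw [ha, norm_inv, norm_pow, Complex.norm_real, Real.norm_of_nonneg hc.le]
  set D := C * 4 ^ (d + 1) with hD
  have hD0 : 0 ≤ D := by positivity
  -- On the diagonal the second term vanishes and the first bounds a single entry; off it only the
  -- summable error remains. Both have bounded row and column sums, as Schur's test requires.
  have hdiag : ∀ n m, ‖latticeMatrix K n m - a * bumpMatrix T n m‖ ≤
      (if n = m then ‖a‖ * B else 0) + D * (‖n - m‖⁻¹) ^ (d + 1) := by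
    intro n m
    rcases eq_or_ne n m with rfl | hnm
    · rw [latticeMatrix_self, zero_sub, norm_neg, norm_mul, if_pos rfl]
      have := mul_le_mul_of_nonneg_left (hM.norm_entry_le hB0 n n) (norm_nonneg a)
      have h0 : 0 ≤ D * (‖n - n‖⁻¹) ^ (d + 1) := by positivity
      linarith
    · rw [latticeMatrix_of_ne hnm, if_neg hnm, zero_add]
      have h1 := h.norm_bumpMatrix_sub_le hT hnm
      have e : K (latticePoint n) (latticePoint m) - a * bumpMatrix T n m =
          -(a * (bumpMatrix T n m - bumpMass d ^ 2 * K (latticePoint n) (latticePoint m))) := by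
        rw [ha]; field_simp; ring
      rw [e, norm_neg, norm_mul, hna]
      rwa [inv_mul_le_iff₀ (by positivity)]
  have hW := latticeTailSum_nonneg (d := d)
  have hE : MatrixBound (fun n m => latticeMatrix K n m - a * bumpMatrix T n m) 2
      ((‖a‖ * B + D * latticeTailSum d) ^ 2) := by
    refine MatrixBound.of_sum_le (by positivity) (fun S n => ?_) (fun N m => ?_)
    · refine (Finset.sum_le_sum fun m _ => hdiag n m).trans ?_
      rw [Finset.sum_add_distrib, ← Finset.mul_sum]
      refine add_le_add ?_ (mul_le_mul_of_nonneg_left ?_ hD0)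
      · rw [Finset.sum_ite_eq]
        split_ifs <;> [exact le_rfl; positivity]
      · simp only [norm_sub_rev n]
        exact sum_inv_norm_sub_pow_le S n
    · refine (Finset.sum_le_sum fun n _ => hdiag n m).trans ?_
      rw [Finset.sum_add_distrib, ← Finset.mul_sum]
      refine add_le_add ?_ (mul_le_mul_of_nonneg_left (sum_inv_norm_sub_pow_le N m) hD0)
      rw [Finset.sum_ite_eq']
      split_ifs <;> [exact le_rfl; positivity]
  refine ⟨_, ?_, by simpa only [sub_add_cancel] using hE.add_two (hM.const_mul a)⟩
  positivity

end Sampling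

/-! ### From finite sections to operators on `ℓ^p`. -/

section Extension

variable {ι : Type*} {k : ι → ι → ℂ} {D : ℝ} {p : ℝ≥0∞}

theorem exists_norm_eq_mul_eq_norm (a z : ℂ) : ∃ w : ℂ, ‖w‖ = ‖z‖ ∧ a * w = (‖a * z‖ : ℝ) := by
  rcases eq_or_ne a 0 with rfl | ha
  · exact ⟨z, rfl, by simp⟩
  have ha' : ‖a‖ ≠ 0 := norm_ne_zero_iff.mpr ha
  refine ⟨(‖a * z‖ : ℝ) / a, ?_, mul_div_cancel₀ _ ha⟩
  rw [norm_div, Complex.norm_real, norm_norm, norm_mul, mul_div_cancel_left₀ _ ha']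

/-- Changing the phases of `f` keeps its norm and makes every term of row `n` nonnegative, so the
finite-section bound controls the sum of absolute values. -/
theorem MatrixBound.summable_mul [Fact (1 ≤ p)] (hp : p ≠ ∞) (hD : 0 ≤ D)
    (h : MatrixBound k p.toReal D) (f : lp (fun _ : ι => ℂ) p) (n : ι) :
    Summable fun m => k n m * f m := by
  have hp0 : 0 < p.toReal := ENNReal.toReal_pos (zero_lt_one.trans_le Fact.out).ne' hp
  choose w hw hkw using fun m => exists_norm_eq_mul_eq_norm (k n m) (f m)
  refine Summable.of_norm (summable_of_sum_le (c := (D * ‖f‖ ^ p.toReal) ^ p.toReal⁻¹)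
    (fun _ => norm_nonneg _) fun S => ?_)
  have h1 := h S {n} w
  simp only [Finset.sum_singleton, hkw, hw, ← Complex.ofReal_sum] at h1
  have h0 : 0 ≤ ∑ m ∈ S, ‖k n m * f m‖ := Finset.sum_nonneg fun _ _ => norm_nonneg _
  rw [Complex.norm_real, Real.norm_of_nonneg h0] at h1
  rw [Real.le_rpow_inv_iff_of_pos h0 (by positivity) hp0]
  exact h1.trans (mul_le_mul_of_nonneg_left (lp.sum_rpow_le_norm_rpow hp0 f S) hD)

theorem MatrixBound.sum_norm_tsum_rpow_le [Fact (1 ≤ p)] (hp : p ≠ ∞) (hD : 0 ≤ D)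
    (h : MatrixBound k p.toReal D) (f : lp (fun _ : ι => ℂ) p) (N : Finset ι) :
    ∑ n ∈ N, ‖∑' m, k n m * f m‖ ^ p.toReal ≤ D * ‖f‖ ^ p.toReal := by
  have hp0 : 0 < p.toReal := ENNReal.toReal_pos (zero_lt_one.trans_le Fact.out).ne' hp
  have ht : Tendsto (fun S : Finset ι => ∑ n ∈ N, ‖∑ m ∈ S, k n m * f m‖ ^ p.toReal) atTop
      (𝓝 (∑ n ∈ N, ‖∑' m, k n m * f m‖ ^ p.toReal)) :=
    tendsto_finsetSum _ fun n _ =>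
      ((h.summable_mul hp hD f n).hasSum.norm).rpow_const (Or.inr hp0.le)
  exact le_of_tendsto' ht fun S => (h S N f).trans
    (mul_le_mul_of_nonneg_left (lp.sum_rpow_le_norm_rpow hp0 f S) hD)

/-- A matrix with bounded finite sections defines a bounded operator on `ℓ^p`. -/
theorem MatrixBound.exists_continuousLinearMap [Fact (1 ≤ p)] (hp : p ≠ ∞) (hD : 0 ≤ D)
    (h : MatrixBound k p.toReal D) :
    ∃ S : lp (fun _ : ι => ℂ) p →L[ℂ] lp (fun _ : ι => ℂ) p,
      ∀ (f : lp (fun _ : ι => ℂ) p) (n : ι), S f n = ∑' m, k n m * f m := by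
  have hp0 : 0 < p.toReal := ENNReal.toReal_pos (zero_lt_one.trans_le Fact.out).ne' hp
  let L : lp (fun _ : ι => ℂ) p →ₗ[ℂ] lp (fun _ : ι => ℂ) p :=
    { toFun := fun f => ⟨fun n => ∑' m, k n m * f m,
        memℓp_gen' fun N => h.sum_norm_tsum_rpow_le hp hD f N⟩
      map_add' := fun f g => by
        ext n
        simp only [lp.coeFn_add, Pi.add_apply, mul_add]
        exact (h.summable_mul hp hD f n).tsum_add (h.summable_mul hp hD g n)
      map_smul' := fun c f => by
        ext n
        simp only [lp.coeFn_smul, Pi.smul_apply, smul_eq_mul, RingHom.id_apply, mul_left_comm _ c]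
        exact tsum_mul_left }
  refine ⟨L.mkContinuous (D ^ p.toReal⁻¹) fun f => ?_, fun f n => rfl⟩
  refine lp.norm_le_of_forall_sum_le hp0 (by positivity) fun N => ?_
  refine (h.sum_norm_tsum_rpow_le hp hD f N).trans_eq ?_
  rw [Real.mul_rpow (by positivity) (norm_nonneg _), Real.rpow_inv_rpow hD hp0.ne']

end Extension

/-! ### The discrete analogue. -/

section DiscreteAnalogue

variable {d : ℕ} {K : EuclideanSpace ℝ (Fin d) → EuclideanSpace ℝ (Fin d) → ℂ}

theorem IsCalderonZygmund.exists_isSmoothKernel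
    {T : 𝓢(EuclideanSpace ℝ (Fin d), ℂ) →ₗ[ℂ] (EuclideanSpace ℝ (Fin d) → ℂ)}
    (hT : IsCalderonZygmund T K) : ∃ C, IsSmoothKernel K C := by
  obtain ⟨C, hC⟩ := hT.smoothness
  refine ⟨max C 0, le_max_right _ _, hT.contDiffOn, fun x y hxy => (hC x y hxy).trans ?_⟩
  gcongr
  exact le_max_left _ _

theorem IsCalderonZygmund.exists_matrixBound
    {T : 𝓢(EuclideanSpace ℝ (Fin d), ℂ) →ₗ[ℂ] (EuclideanSpace ℝ (Fin d) → ℂ)}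
    (hT : IsCalderonZygmund T K) {p : ℝ} (hp : 1 < p) :
    ∃ D, 0 ≤ D ∧ MatrixBound (latticeMatrix K) p D := by
  rcases eq_or_ne d 0 with rfl | hd
  -- For `d = 0` the lattice is one point and the matrix, having zero diagonal, vanishes.
  · refine ⟨0, le_rfl, fun S N f => ?_⟩
    have h0 : ∀ n m, latticeMatrix K n m = 0 := fun n m => by
      rw [Subsingleton.elim n m, latticeMatrix_self]
    simp [h0, Real.zero_rpow (zero_lt_one.trans hp).ne']
  · obtain ⟨C, hC⟩ := hT.exists_isSmoothKernel
    obtain ⟨B, hB, h2⟩ := hC.exists_matrixBound_two hT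
    have hC0 := hC.nonneg
    refine RegularMatrix.exists_matrixBound hd hB (by positivity) (hC.regularMatrix hd) ?_ h2 hp
    rw [← latticeMatrix_swap]
    exact hC.swap.regularMatrix hd

theorem discreteTerm_eq (f : (Fin d → ℤ) → ℂ) (n : Fin d → ℤ) :
    discreteTerm K f n =
      (fun m => latticeMatrix K n m * f m) ∘ ((↑) : {m : Fin d → ℤ // m ≠ n} → Fin d → ℤ) := by
  ext m
  simp only [discreteTerm, Function.comp_apply, latticeMatrix_of_ne m.2.symm]

theorem discreteAnalogue_eq (f : (Fin d → ℤ) → ℂ) (n : Fin d → ℤ) :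
    discreteAnalogue K f n = ∑' m, latticeMatrix K n m * f m := by
  rw [discreteAnalogue, discreteTerm_eq]
  refine tsum_subtype_eq_of_support_subset (f := fun m => latticeMatrix K n m * f m)
    (s := {m | m ≠ n}) fun m hm hmn => hm ?_
  subst hmn
  simp only [latticeMatrix_self, zero_mul]

end DiscreteAnalogue

theorem theoremA1 {d : ℕ}
    (T : 𝓢(EuclideanSpace ℝ (Fin d), ℂ) →ₗ[ℂ] (EuclideanSpace ℝ (Fin d) → ℂ))
    (K : EuclideanSpace ℝ (Fin d) → EuclideanSpace ℝ (Fin d) → ℂ)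
    (hT : IsCalderonZygmund T K)
    (p : ℝ≥0∞) [Fact (1 ≤ p)] (hp : 1 < p) (hp' : p < ∞) :
    (∀ (f : lp (fun _ : Fin d → ℤ => ℂ) p) (n : Fin d → ℤ), Summable (discreteTerm K f n)) ∧
    ∃ S : lp (fun _ : Fin d → ℤ => ℂ) p →L[ℂ] lp (fun _ : Fin d → ℤ => ℂ) p,
      ∀ (f : lp (fun _ : Fin d → ℤ => ℂ) p) (n : Fin d → ℤ),
        S f n = discreteAnalogue K f n := by
  have hp1 : 1 < p.toReal := by
    rw [← ENNReal.toReal_one]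
    exact ENNReal.toReal_strict_mono hp'.ne hp
  obtain ⟨D, hD, h⟩ := hT.exists_matrixBound hp1
  refine ⟨fun f n => ?_, ?_⟩
  · rw [discreteTerm_eq]
    exact (h.summable_mul hp'.ne hD f n).comp_injective Subtype.val_injective
  · obtain ⟨S, hS⟩ := h.exists_continuousLinearMap hp'.ne hD
    exact ⟨S, fun f n => (hS f n).trans (discreteAnalogue_eq _ _).symm⟩
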